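/- Let $F$ be a free group with basis $A$ and let $H\le F$ be a subgroup. An element $g\in F$ *depends on* $H$ if there is a nontrivial element $w(x)$ of the free product $H * F(x)$, with $F(x)$ free on one generator $x$, such that $w(g)=1$ in $F$. Let $\mathrm{dep}(H)$ be the set of elements of $F$ that depend on $H$, and let $\mathrm{Dep}(H)=\langle \mathrm{dep}(H)\rangle$. The Schreier coset graph of $H$ has as vertices the right cosets $Hg$, $g\in F$, and for every coset $Hg$ and every $a\in A$ an edge labelled $a$ from $Hg$ to $Hga$; its root is $H1$. The core $C(H)$ is the union of the root and of all reduced closed paths at the root. For vertices $u,v$ of $C(H)$ let $C(H)/(u=v)$ be the labelled graph that is obtained from $C(H)$ by identifying $u$ with $v$ and then folding completely (edges with the same label and the same initial vertex, or the same label and the same terminal vertex, are identified, together with their other endpoints, as long as possible). Let $b_1$ denote the first Betti number and put $$P=\{(u,v)\in V(C(H))\times V(C(H)) : b_1(C(H)/(u=v))\le b_1(C(H))\}.$$ 1. If $H$ is finitely generated, a finite generating set of $\mathrm{Dep}(H)$ can be computed effectively: there is an algorithm which, given any finite list of words that generate $H$, written in finitely many letters that stand for distinct elements of $A$, outputs a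 finite list of words in these letters that generate $\mathrm{Dep}(H)$. One such algorithm, operating on words in abstract letters, works for all free groups $F$, all bases $A$ and all finitely generated $H$. 2. Let $H$ be finitely generated, and for every vertex $u$ of $C(H)$ choose an element of $F$ in the coset $u$, denoted again by $u$ (for instance a shortest element of that coset). Then $P$ is finite, $$\mathrm{Dep}(H)=\langle H,\ uv^{-1} : (u,v)\in P\rangle,$$ and $\mathrm{dep}(H)$ is the finite union of double cosets $$\mathrm{dep}(H)=\bigcup_{(u,v)\in P} H\,uv^{-1}H .$$ -/

import Mathlib

universe u v

section Dependence

variable {F : Type u} [Group F]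

/-- `g` depends on `H` if it satisfies a nontrivial univariate equation `w(x) = 1` over `H`, that
is, if some `w ≠ 1` in the free product `H * F(x)` becomes trivial in the ambient group under
`x ↦ g`, `h ↦ h` for `h ∈ H`. -/
def DependsOnSubgroup (g : F) (H : Subgroup F) : Prop :=
  ∃ w : Monoid.Coprod H (FreeGroup Unit),
    w ≠ 1 ∧ Monoid.Coprod.lift H.subtype (FreeGroup.lift fun _ : Unit => g) w = 1

/-- The set of elements that depend on `H`. -/
def dependentSet (H : Subgroup F) : Set F := {g | DependsOnSubgroup g H}

/-- The dependent subgroup of `H`, generated by the elements that depend on `H`. -/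
def dependentSubgroup (H : Subgroup F) : Subgroup F := Subgroup.closure (dependentSet H)

end Dependence

/-- A directed graph with vertex set `V` and edges labelled by `A`, where an edge is determined by
its initial vertex, its label and its terminal vertex (loops, and parallel edges with distinct
labels, are allowed). -/
structure LabelledGraph (A : Type u) (V : Type v) where
  /-- there is an edge from `x` to `y` with label `a` -/
  Edge : V → A → V → Prop

namespace LabelledGraph

variable {A : Type u} {V : Type v} (G : LabelledGraph A V)

/-- One step along an edge. The letter `(a, true)` stands for `a`, read along an edge labelled `a`;
the letter `(a, false)` stands for `a⁻¹`, read along such an edge in the opposite direction. -/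
def Step (x : V) : A × Bool → V → Prop
  | (a, true), y => G.Edge x a y
  | (a, false), y => G.Edge y a x

/-- `G.Reads x w y`: some path from `x` to `y` has the word `w` as its label. -/
inductive Reads : V → List (A × Bool) → V → Prop
  | nil (x : V) : Reads x [] x
  | cons {x y z : V} {l : A × Bool} {w : List (A × Bool)} :
      G.Step x l y → Reads y w z → Reads x (l :: w) z

/-- The vertices of the core at the root `r`: those on a closed path at `r` with reduced label
(the empty path gives `r` itself). In a graph in which no two edges with the same label share
their initial or their terminal vertex, such as a Schreier coset graph, a path is reduced if and
only if its label is reduced. -/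
def coreVerts (r : V) : Set V :=
  {x | ∃ w₁ w₂ : List (A × Bool),
    FreeGroup.IsReduced (w₁ ++ w₂) ∧ G.Reads r w₁ x ∧ G.Reads x w₂ r}

/-- The core at the root `r`: the union of `r` and of all reduced closed paths at `r`. (An edge that
is traversed backwards by such a path is traversed forwards by the inverse path, so that it is enough
to ask for edges that are traversed forwards.) -/
def core (r : V) : LabelledGraph A (G.coreVerts r) where
  Edge x a y := ∃ w₁ w₂ : List (A × Bool),
    FreeGroup.IsReduced (w₁ ++ (a, true) :: w₂) ∧
      G.Reads r w₁ x ∧ G.Edge x a y ∧ G.Reads y w₂ r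

/-- The equivalence relation on vertices that results from identifying `u` with `v` and then folding:
the least equivalence relation that relates `u` to `v` and such that edges with the same label and
with related initial (terminal) vertices have related terminal (initial) vertices. -/
inductive FoldRel (u v : V) : V → V → Prop
  | ident : FoldRel u v u v
  | refl (x : V) : FoldRel u v x x
  | symm {x y : V} : FoldRel u v x y → FoldRel u v y x
  | trans {x y z : V} : FoldRel u v x y → FoldRel u v y z → FoldRel u v x z
  | terminal {x x' y y' : V} {a : A} :
      G.Edge x a x' → G.Edge y a y' → FoldRel u v x y → FoldRel u v x' y'
  | initial {x x' y y' : V} {a : A} :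
      G.Edge x a x' → G.Edge y a y' → FoldRel u v x' y' → FoldRel u v x y

/-- `FoldRel` as a setoid. -/
def foldSetoid (u v : V) : Setoid V where
  r := G.FoldRel u v
  iseqv := ⟨FoldRel.refl, FoldRel.symm, FoldRel.trans⟩

/-- The folded quotient graph `G / (u = v)`: its edges are the images of the edges of `G`, and edges
with the same label, initial vertex and terminal vertex are the same edge. -/
def foldedQuotient (u v : V) : LabelledGraph A (Quotient (G.foldSetoid u v)) where
  Edge X a Y := ∃ x y : V, Quotient.mk (G.foldSetoid u v) x = X ∧
    Quotient.mk (G.foldSetoid u v) y = Y ∧ G.Edge x a y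

/-- The type of all edges `(x, a, y)`. -/
def Edges : Type (max u v) := {e : V × A × V // G.Edge e.1 e.2.1 e.2.2}

/-- The boundary map from 1-chains to 0-chains, which takes an edge to its terminal vertex minus its
initial vertex. -/
noncomputable def boundary : (G.Edges →₀ ℚ) →ₗ[ℚ] (V →₀ ℚ) :=
  Finsupp.linearCombination ℚ fun e : G.Edges =>
    Finsupp.single e.1.2.2 (1 : ℚ) - Finsupp.single e.1.1 (1 : ℚ)

/-- The first Betti number: the dimension of the first homology (the space of 1-cycles), as a
cardinal. -/
noncomputable def betti : Cardinal.{max u v} :=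
  Module.rank ℚ (LinearMap.ker G.boundary)

end LabelledGraph

section Stallings

variable {F : Type u} [Group F] {A : Type v}

/-- The set of right cosets `H g`. -/
abbrev RightCosets (H : Subgroup F) : Type u := Quotient (QuotientGroup.rightRel H)

/-- The right coset `H g`. -/
def rightCosetMk (H : Subgroup F) (g : F) : RightCosets H :=
  Quotient.mk (QuotientGroup.rightRel H) g

/-- The Schreier coset graph of `H` for the basis `b`: for each right coset `H g` and each `a` there
is an edge labelled `a` from `H g` to `H g a`. -/
def schreierGraph (b : FreeGroupBasis A F) (H : Subgroup F) :
    LabelledGraph A (RightCosets H) where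
  Edge x a y := ∃ g : F, x = rightCosetMk H g ∧ y = rightCosetMk H (g * b a)

/-- The vertices of the Stallings core graph of `H`, as a set of right cosets. -/
abbrev CoreVertex (b : FreeGroupBasis A F) (H : Subgroup F) : Type u :=
  (schreierGraph b H).coreVerts (rightCosetMk H 1)

/-- The Stallings core graph of `H` for the basis `b`, with root the coset `H 1`. -/
def coreGraph (b : FreeGroupBasis A F) (H : Subgroup F) :
    LabelledGraph A (CoreVertex b H) :=
  (schreierGraph b H).core (rightCosetMk H 1)

/-- The pairs of vertices of the core graph whose identification, followed by folding, does not
raise the first Betti number. -/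
def nonRaisingPairs (b : FreeGroupBasis A F) (H : Subgroup F) :
    Set (CoreVertex b H × CoreVertex b H) :=
  {p | ((coreGraph b H).foldedQuotient p.1 p.2).betti ≤ (coreGraph b H).betti}

end Stallings

section Words

variable {F : Type u} [Group F]

/-- The value in `F` of a word over the letters `0, 1, 2, …` and their formal inverses, where the
letter `i` stands for `e i`. -/
def evalWord (e : ℕ → F) (w : List (ℕ × Bool)) : F := FreeGroup.lift e (FreeGroup.mk w)

/-- The subgroup generated by a finite list of words. -/
def subgroupOfWords (e : ℕ → F) (L : List (List (ℕ × Bool))) : Subgroup F :=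
  Subgroup.closure {g | ∃ w ∈ L, evalWord e w = g}

/-- The letters that occur, with either sign, in a list of words. -/
def lettersOf (L : List (List (ℕ × Bool))) : Set ℕ :=
  {i | ∃ w ∈ L, ∃ s : Bool, (i, s) ∈ w}

end Words

/-!
An element `g` depends on a finitely generated subgroup `H` of a free group if and only if the
canonical surjection from `H * F(x)` to `⟨H, g⟩` is not injective. Finitely generated free groups
are Hopfian, so this happens if and only if `rank ⟨H, g⟩ ≤ rank H` (`dependsOnSubgroup_iff`).

Ranks are read off from graphs. Call a rooted labelled graph a Stallings graph of `K` if it is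
folded and connected and the labels of its closed paths at the root are the elements of `K`.
Sending an element of `K` to the 1-chain of a closed path with this label turns a basis of `K` into
a basis of the first homology, so that the Betti number is the rank of `K`
(`IsStallings.nonempty_linearEquiv`, `IsStallings.lift_betti`). The core graph is a Stallings graph
of `H` (`coreGraph_isStallings`), and identifying the end points of two paths at the root with
labels `u` and `v`, followed by folding, gives a Stallings graph of `⟨H, u v⁻¹⟩`
(`IsStallings.foldedQuotient`). Hence a pair `(u, v)` of core vertices does not raise the Betti
number if and only if `u v⁻¹` depends on `H` (`mem_nonRaisingPairs_iff`).

It remains to see that every dependent `g` lies in `H u v⁻¹ H` for some core vertices `u` and `v`.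
The labels of the reduced paths at the root of the core graph span an `H`-invariant subtree `T` of
the Cayley tree, and the claim is that `T` meets `g T`. If it does not, `T` can be enlarged until a
single edge leads from `T` to `g T` (`IsInvariantTree.exists_adjacent`). For every homomorphism
from `H` to a group and every element `y` of that group there is then an induced action of the free
group in which this edge is rerouted, such that `H` acts by the given homomorphism and `g` by `y`
(`IsInvariantTree.exists_action`). With `H * F(x)` as the group and `x` as the element, this
separates every nontrivial element of `H * F(x)` from `1`, so that `g` does not depend on `H`
(`IsInvariantTree.exists_mul_mem_of_depends`). The core graph is finite because it is contained in
the graph of the prefixes of generating words (`finite_coreVertex`).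

For the algorithm, two prefixes of the given words represent the same coset if and only if they are
identified by every relation on the prefixes that closes up the words and is stable under folding
(`sameCoset_iff`). There are finitely many such relations, so that the numbers of vertices and
edges of the prefix graph can be computed, and with them, through the Euler characteristic, the
rank (`card_add_vertexCount`) and the dependence of every quotient of two prefixes
(`dependenceTest_iff`). All searches are bounded, which makes the algorithm primitive recursive
(`primrec_dependentWords`). It operates on the free group on all letters; the result is carried
over to `F` because the letters that occur stand for distinct basis elements
(`subgroupOfWords_dependentWords`).
-/

universe w w'

/-! ### Paths in labelled graphs -/

namespace LabelledGraph

variable {A : Type u} {V : Type v} {G : LabelledGraph A V}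

/-- A labelled graph is deterministic (folded) if no two edges with the same label share their
initial or their terminal vertex. -/
def Deterministic (G : LabelledGraph A V) : Prop :=
  ∀ ⦃x : V⦄ ⦃l : A × Bool⦄ ⦃y z : V⦄, G.Step x l y → G.Step x l z → y = z

theorem step_not_iff {x y : V} {a : A} {s : Bool} :
    G.Step y (a, !s) x ↔ G.Step x (a, s) y := by
  cases s <;> exact Iff.rfl

theorem reads_nil_iff {x y : V} : G.Reads x [] y ↔ x = y := by
  constructor
  · rintro ⟨⟩; rfl
  · rintro rfl; exact .nil x

theorem reads_cons_iff {x z : V} {l : A × Bool} {w : List (A × Bool)} :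
    G.Reads x (l :: w) z ↔ ∃ y, G.Step x l y ∧ G.Reads y w z := by
  constructor
  · rintro (_ | ⟨h, h'⟩); exact ⟨_, h, h'⟩
  · rintro ⟨y, h, h'⟩; exact .cons h h'

theorem reads_append_iff {x z : V} {w₁ w₂ : List (A × Bool)} :
    G.Reads x (w₁ ++ w₂) z ↔ ∃ y, G.Reads x w₁ y ∧ G.Reads y w₂ z := by
  induction w₁ generalizing x with
  | nil => simp [reads_nil_iff]
  | cons l w ih => simp only [List.cons_append, reads_cons_iff, ih]; grind

theorem reads_singleton_iff {x y : V} {l : A × Bool} : G.Reads x [l] y ↔ G.Step x l y := by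
  simp [reads_cons_iff, reads_nil_iff]

theorem Reads.append {x y z : V} {w₁ w₂ : List (A × Bool)} (h₁ : G.Reads x w₁ y)
    (h₂ : G.Reads y w₂ z) : G.Reads x (w₁ ++ w₂) z :=
  reads_append_iff.2 ⟨y, h₁, h₂⟩

theorem Reads.invRev {x y : V} {w : List (A × Bool)} (h : G.Reads x w y) :
    G.Reads y (FreeGroup.invRev w) x := by
  induction h with
  | nil x => exact .nil x
  | @cons x y z l w h _ ih =>
    rw [FreeGroup.invRev_cons]
    exact ih.append (reads_singleton_iff.2 (step_not_iff.2 h))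

theorem Reads.unique (hG : G.Deterministic) {x y z : V} {w : List (A × Bool)}
    (h₁ : G.Reads x w y) (h₂ : G.Reads x w z) : y = z := by
  induction h₁ with
  | nil x => exact reads_nil_iff.1 h₂
  | cons h _ ih =>
    obtain ⟨y', hy', h'⟩ := reads_cons_iff.1 h₂
    obtain rfl := hG h hy'
    exact ih h'

/-- In a deterministic graph a path may be freely reduced without leaving the graph. -/
theorem Reads.red (hG : G.Deterministic) {x y : V} {w w' : List (A × Bool)}
    (hw : FreeGroup.Red w w') (h : G.Reads x w y) : G.Reads x w' y := by
  induction hw with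
  | refl => exact h
  | tail _ hs ih =>
    obtain @⟨w₁, w₂, a, s⟩ := hs
    obtain ⟨p, hp, h'⟩ := reads_append_iff.1 ih
    obtain ⟨q, hq, h'⟩ := reads_cons_iff.1 h'
    obtain ⟨p', hp', h'⟩ := reads_cons_iff.1 h'
    obtain rfl := hG (step_not_iff.2 hq) hp'
    exact hp.append h'

theorem Reads.eq_of_mk_eq (hG : G.Deterministic) {x y z : V} {w w' : List (A × Bool)}
    (h : G.Reads x w y) (h' : G.Reads x w' z) (hw : FreeGroup.mk w = FreeGroup.mk w') :
    y = z := by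
  obtain ⟨c, hc, hc'⟩ := FreeGroup.Red.exact.1 hw
  exact (h.red hG hc).unique hG (h'.red hG hc')

theorem Reads.mono {V' : Type*} {G' : LabelledGraph A V'} (f : V → V')
    (hf : ∀ x a y, G.Edge x a y → G'.Edge (f x) a (f y)) {x y : V} {w : List (A × Bool)}
    (h : G.Reads x w y) : G'.Reads (f x) w (f y) := by
  induction h with
  | nil x => exact .nil _
  | @cons x y z l w h _ ih =>
    obtain ⟨a, s⟩ := l
    refine .cons ?_ ih
    cases s <;> exact hf _ _ _ h

/-- The group elements that label closed paths at `r` form a subgroup, so a set of labels of closed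
paths generates only labels of closed paths. -/
theorem exists_reads_of_mem_closure {F : Type*} [Group F] (φ : FreeGroup A →* F) {r : V}
    {S : Set F} (hS : ∀ g ∈ S, ∃ w, G.Reads r w r ∧ φ (FreeGroup.mk w) = g) {g : F}
    (hg : g ∈ Subgroup.closure S) : ∃ w, G.Reads r w r ∧ φ (FreeGroup.mk w) = g := by
  induction hg using Subgroup.closure_induction with
  | mem g hg => exact hS g hg
  | one => exact ⟨[], .nil r, map_one φ⟩
  | mul g h _ _ ihg ihh =>
    obtain ⟨w, hw, rfl⟩ := ihg
    obtain ⟨w', hw', rfl⟩ := ihh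
    exact ⟨w ++ w', hw.append hw', by rw [← FreeGroup.mul_mk, map_mul]⟩
  | inv g _ ih =>
    obtain ⟨w, hw, rfl⟩ := ih
    exact ⟨_, hw.invRev, by rw [← FreeGroup.inv_mk, map_inv]⟩

/-! ### The 1-chain of a path -/

/-- The 1-chain of a single step: the edge itself, or its negative if it is read backwards. -/
noncomputable def stepChain {x y : V} : {l : A × Bool} → G.Step x l y → (G.Edges →₀ ℚ)
  | (a, true), h => Finsupp.single ⟨(x, a, y), h⟩ 1
  | (a, false), h => -Finsupp.single ⟨(y, a, x), h⟩ 1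

/-- `G.Traces x w y c`: some path from `x` to `y` has label `w` and 1-chain `c`. -/
inductive Traces (G : LabelledGraph A V) : V → List (A × Bool) → V → (G.Edges →₀ ℚ) → Prop
  | nil (x : V) : Traces G x [] x 0
  | cons {x y z : V} {l : A × Bool} {w : List (A × Bool)} {c : G.Edges →₀ ℚ} (h : G.Step x l y) :
      Traces G y w z c → Traces G x (l :: w) z (stepChain h + c)

theorem Reads.exists_traces {x y : V} {w : List (A × Bool)} (h : G.Reads x w y) :
    ∃ c, G.Traces x w y c := by
  induction h with
  | nil x => exact ⟨0, .nil x⟩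
  | cons h _ ih => exact ⟨_, .cons h ih.choose_spec⟩

theorem Traces.reads {x y : V} {w : List (A × Bool)} {c : G.Edges →₀ ℚ} (h : G.Traces x w y c) :
    G.Reads x w y := by
  induction h with
  | nil x => exact .nil x
  | cons h _ ih => exact .cons h ih

theorem Traces.append {x y z : V} {w₁ w₂ : List (A × Bool)} {c₁ c₂ : G.Edges →₀ ℚ}
    (h₁ : G.Traces x w₁ y c₁) (h₂ : G.Traces y w₂ z c₂) :
    G.Traces x (w₁ ++ w₂) z (c₁ + c₂) := by
  induction h₁ with
  | nil x => simpa using h₂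
  | cons h _ ih => simpa [add_assoc] using Traces.cons h (ih h₂)

theorem traces_append {x z : V} {w₁ w₂ : List (A × Bool)} {c : G.Edges →₀ ℚ}
    (h : G.Traces x (w₁ ++ w₂) z c) :
    ∃ y c₁ c₂, G.Traces x w₁ y c₁ ∧ G.Traces y w₂ z c₂ ∧ c = c₁ + c₂ := by
  induction w₁ generalizing x c with
  | nil => exact ⟨x, 0, c, .nil x, h, by simp⟩
  | cons l w ih =>
    obtain _ | ⟨h, h'⟩ := h
    obtain ⟨y, c₁, c₂, h₁, h₂, rfl⟩ := ih h'
    exact ⟨y, _, c₂, .cons h h₁, h₂, by rw [add_assoc]⟩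

theorem stepChain_not {x y : V} {a : A} {s : Bool} (h : G.Step x (a, s) y)
    (h' : G.Step y (a, !s) x) : stepChain h' = -stepChain h := by
  cases s
  · exact (neg_neg _).symm
  · rfl

theorem traces_singleton {x y : V} {l : A × Bool} (h : G.Step x l y) :
    G.Traces x [l] y (stepChain h) := by
  simpa using Traces.cons h (.nil y)

theorem Traces.invRev {x y : V} {w : List (A × Bool)} {c : G.Edges →₀ ℚ} (h : G.Traces x w y c) :
    G.Traces y (FreeGroup.invRev w) x (-c) := by
  induction h with
  | nil x => simpa using Traces.nil x
  | @cons x y z l w c h _ ih =>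
    rw [FreeGroup.invRev_cons, neg_add_rev, ← stepChain_not h (step_not_iff.2 h)]
    exact ih.append (traces_singleton (step_not_iff.2 h))

theorem Traces.unique (hG : G.Deterministic) {x y z : V} {w : List (A × Bool)}
    {c c' : G.Edges →₀ ℚ} (h₁ : G.Traces x w y c) (h₂ : G.Traces x w z c') : c = c' := by
  induction h₁ generalizing c' with
  | nil x => cases h₂; rfl
  | cons h _ ih =>
    obtain _ | ⟨h', h''⟩ := h₂
    obtain rfl := hG h h'
    rw [ih h'']

theorem Traces.red (hG : G.Deterministic) {x y : V} {w w' : List (A × Bool)} {c : G.Edges →₀ ℚ}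
    (hw : FreeGroup.Red w w') (h : G.Traces x w y c) : G.Traces x w' y c := by
  induction hw with
  | refl => exact h
  | tail _ hs ih =>
    obtain @⟨w₁, w₂, a, s⟩ := hs
    obtain ⟨p, c₁, c₂, hp, h', rfl⟩ := traces_append ih
    obtain _ | ⟨hq, h'⟩ := h'
    obtain _ | ⟨hp', h'⟩ := h'
    obtain rfl := hG (step_not_iff.2 hq) hp'
    rw [stepChain_not hq hp', add_neg_cancel_left]
    exact hp.append h'

/-- In a deterministic graph the chain of a path depends only on the initial vertex and on the group
element that labels the path. -/
theorem Traces.eq_of_mk_eq (hG : G.Deterministic) {x y z : V} {w w' : List (A × Bool)}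
    {c c' : G.Edges →₀ ℚ} (h : G.Traces x w y c) (h' : G.Traces x w' z c')
    (hw : FreeGroup.mk w = FreeGroup.mk w') : c = c' := by
  obtain ⟨v, hv, hv'⟩ := FreeGroup.Red.exact.1 hw
  exact (h.red hG hv).unique hG (h'.red hG hv')

theorem boundary_single (e : G.Edges) :
    G.boundary (Finsupp.single e 1) = Finsupp.single e.1.2.2 1 - Finsupp.single e.1.1 1 := by
  simp [boundary]

theorem boundary_stepChain {x y : V} {l : A × Bool} (h : G.Step x l y) :
    G.boundary (stepChain h) = Finsupp.single y 1 - Finsupp.single x 1 := by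
  obtain ⟨a, s⟩ := l
  cases s
  · exact (map_neg _ _).trans
      ((congrArg Neg.neg (boundary_single ⟨(y, a, x), h⟩)).trans (neg_sub _ _))
  · exact boundary_single ⟨(x, a, y), h⟩

theorem Traces.boundary {x y : V} {w : List (A × Bool)} {c : G.Edges →₀ ℚ}
    (h : G.Traces x w y c) :
    G.boundary c = Finsupp.single y 1 - Finsupp.single x 1 := by
  induction h with
  | nil x => simp
  | @cons x y z l w c h _ ih =>
    rw [map_add, ih, boundary_stepChain]
    abel

end LabelledGraph

/-! ### The Betti number of a rooted graph is the rank of its group -/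

namespace LabelledGraph

variable {A : Type u} {V : Type v} {G : LabelledGraph A V} {F : Type w} [Group F]

/-- The label of a path as an element of a group with basis `b`. -/
def wordValue (b : FreeGroupBasis A F) (w : List (A × Bool)) : F := b.repr.symm (FreeGroup.mk w)

theorem wordValue_append (b : FreeGroupBasis A F) (w w' : List (A × Bool)) :
    wordValue b (w ++ w') = wordValue b w * wordValue b w' := by
  rw [wordValue, ← FreeGroup.mul_mk, map_mul]; rfl

@[simp] theorem wordValue_nil (b : FreeGroupBasis A F) : wordValue b [] = 1 := map_one b.repr.symm

theorem wordValue_invRev (b : FreeGroupBasis A F) (w : List (A × Bool)) :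
    wordValue b (FreeGroup.invRev w) = (wordValue b w)⁻¹ := by
  rw [wordValue, ← FreeGroup.inv_mk, map_inv]; rfl

theorem wordValue_true (b : FreeGroupBasis A F) (a : A) : wordValue b [(a, true)] = b a := rfl

theorem wordValue_false (b : FreeGroupBasis A F) (a : A) : wordValue b [(a, false)] = (b a)⁻¹ := by
  rw [← wordValue_true, ← wordValue_invRev]; rfl

theorem wordValue_cons (b : FreeGroupBasis A F) (l : A × Bool) (w : List (A × Bool)) :
    wordValue b (l :: w) = wordValue b [l] * wordValue b w :=
  wordValue_append b [l] w

theorem wordValue_inj (b : FreeGroupBasis A F) {w w' : List (A × Bool)} :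
    wordValue b w = wordValue b w' ↔ FreeGroup.mk w = FreeGroup.mk w' :=
  b.repr.symm.injective.eq_iff

/-- `G` is a Stallings graph of the subgroup `K` with root `r`: it is deterministic and connected,
and `K` is the set of labels of closed paths at `r`. -/
structure IsStallings (G : LabelledGraph A V) (b : FreeGroupBasis A F) (r : V) (K : Subgroup F) :
    Prop where
  det : G.Deterministic
  conn : ∀ x, ∃ w, G.Reads r w x
  mem_iff : ∀ k, k ∈ K ↔ ∃ w, G.Reads r w r ∧ wordValue b w = k

variable {b : FreeGroupBasis A F} {r : V} {K : Subgroup F}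

/-- An additive character on `K` extends to chains by evaluating it on each edge, closed up through
the potential `τ`; on the chain of a path it then evaluates the label of the path. -/
theorem Traces.linear_eq {M : Type*} [AddCommGroup M] [Module ℚ M] (χ : K →* Multiplicative M)
    (τ : V → F) (hτ : ∀ e : G.Edges, τ e.1.1 * b e.1.2.1 * (τ e.1.2.2)⁻¹ ∈ K)
    (B : (G.Edges →₀ ℚ) →ₗ[ℚ] M)
    (hB : ∀ e, B (Finsupp.single e 1) = (χ ⟨_, hτ e⟩).toAdd)
    {x y : V} {w : List (A × Bool)} {c : G.Edges →₀ ℚ} (h : G.Traces x w y c) :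
    ∃ hk : τ x * wordValue b w * (τ y)⁻¹ ∈ K, B c = (χ ⟨_, hk⟩).toAdd := by
  induction h with
  | nil x =>
    have h1 : τ x * wordValue b [] * (τ x)⁻¹ = 1 := by simp
    refine ⟨h1 ▸ K.one_mem, ?_⟩
    have : (⟨_, h1 ▸ K.one_mem⟩ : K) = 1 := Subtype.ext h1
    rw [this]; simp
  | @cons x y z l w c h _ ih =>
    obtain ⟨hk, hc⟩ := ih
    have key : ∃ hs : τ x * wordValue b [l] * (τ y)⁻¹ ∈ K,
        B (stepChain h) = (χ ⟨_, hs⟩).toAdd := by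
      obtain ⟨a, s⟩ := l
      cases s
      · have h1 : τ x * wordValue b [(a, false)] * (τ y)⁻¹ = (τ y * b a * (τ x)⁻¹)⁻¹ := by
          rw [wordValue_false]; group
        have h2 := K.inv_mem (hτ ⟨(y, a, x), h⟩)
        refine ⟨h1 ▸ h2, ?_⟩
        have : (⟨_, h1 ▸ h2⟩ : K) = (⟨_, hτ ⟨(y, a, x), h⟩⟩ : K)⁻¹ := Subtype.ext h1
        rw [this, map_inv, toAdd_inv]
        exact (map_neg B _).trans (congrArg Neg.neg (hB ⟨(y, a, x), h⟩))
      · exact ⟨hτ ⟨(x, a, y), h⟩, hB ⟨(x, a, y), h⟩⟩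
    obtain ⟨hs, hs'⟩ := key
    have h1 : τ x * wordValue b (l :: w) * (τ z)⁻¹ =
        (τ x * wordValue b [l] * (τ y)⁻¹) * (τ y * wordValue b w * (τ z)⁻¹) := by
      rw [wordValue_cons]; group
    refine ⟨h1 ▸ K.mul_mem hs hk, ?_⟩
    have : (⟨_, h1 ▸ K.mul_mem hs hk⟩ : K) = ⟨_, hs⟩ * ⟨_, hk⟩ := Subtype.ext h1
    rw [this, map_mul, toAdd_mul, map_add, hc, hs']

/-- The first homology of a Stallings graph of `K` has a basis in bijection with any free basis
of `K`. -/
theorem IsStallings.nonempty_linearEquiv (hG : G.IsStallings b r K) {ι : Type*}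
    (κ : FreeGroupBasis ι K) : Nonempty (LinearMap.ker G.boundary ≃ₗ[ℚ] (ι →₀ ℚ)) := by
  classical
  choose path hpath using hG.conn
  choose pchain hpchain using fun x => (hpath x).exists_traces
  choose loop hloop hval using fun k : K => (hG.mem_iff k).1 k.2
  choose Θ hΘ using fun k => (hloop k).exists_traces
  -- any closed path at the root labelled by `k` has the chain `Θ k`
  have hΘ_eq : ∀ (k : K) (w : List (A × Bool)) (c : G.Edges →₀ ℚ), G.Traces r w r c →
      wordValue b w = k → Θ k = c := fun k w c h hw =>
    (hΘ k).eq_of_mk_eq hG.det h ((wordValue_inj b).1 ((hval k).trans hw.symm))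
  let θ : K →* Multiplicative (G.Edges →₀ ℚ) :=
    { toFun := fun k => .ofAdd (Θ k)
      map_one' := by rw [hΘ_eq 1 [] 0 (.nil r) (by simp)]; rfl
      map_mul' := fun k k' => by
        rw [hΘ_eq (k * k') _ _ ((hΘ k).append (hΘ k')) (by simp [wordValue_append, hval])]; rfl }
  let χ : K →* Multiplicative (ι →₀ ℚ) := κ.lift fun i => .ofAdd (Finsupp.single i 1)
  have hχ : ∀ i, χ (κ i) = .ofAdd (Finsupp.single i 1) := fun i => by simp [χ]
  let τ : V → F := fun x => wordValue b (path x)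
  have hτ' : ∀ e : G.Edges, G.Traces r (path e.1.1 ++ ([(e.1.2.1, true)] ++
      FreeGroup.invRev (path e.1.2.2))) r
      (pchain e.1.1 + (Finsupp.single e 1 + -pchain e.1.2.2)) := fun e =>
    (hpchain _).append ((traces_singleton (l := (e.1.2.1, true)) e.2).append (hpchain _).invRev)
  have hτ'' : ∀ e : G.Edges, wordValue b (path e.1.1 ++ ([(e.1.2.1, true)] ++
      FreeGroup.invRev (path e.1.2.2))) = τ e.1.1 * b e.1.2.1 * (τ e.1.2.2)⁻¹ := fun e => by
    rw [wordValue_append, wordValue_append, wordValue_invRev, wordValue_true, ← mul_assoc]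
  have hτ : ∀ e : G.Edges, τ e.1.1 * b e.1.2.1 * (τ e.1.2.2)⁻¹ ∈ K := fun e =>
    (hG.mem_iff _).2 ⟨_, (hτ' e).reads, hτ'' e⟩
  let B : (G.Edges →₀ ℚ) →ₗ[ℚ] (ι →₀ ℚ) :=
    Finsupp.linearCombination ℚ fun e => (χ ⟨_, hτ e⟩).toAdd
  have hB : ∀ e, B (Finsupp.single e 1) = (χ ⟨_, hτ e⟩).toAdd := fun e => by simp [B]
  let α : (ι →₀ ℚ) →ₗ[ℚ] (G.Edges →₀ ℚ) := Finsupp.linearCombination ℚ fun i => Θ (κ i)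
  have hα : ∀ k, α (χ k).toAdd = Θ k := by
    have : (AddMonoidHom.toMultiplicative α.toAddMonoidHom).comp χ = θ := by
      refine κ.ext_hom _ _ fun i => ?_
      change Multiplicative.ofAdd (α (χ (κ i)).toAdd) = .ofAdd (Θ (κ i))
      rw [hχ]; simp [α]
    exact fun k => congrArg Multiplicative.toAdd (DFunLike.congr_fun this k)
  have hBΘ : ∀ k, B (Θ k) = (χ k).toAdd := fun k => by
    obtain ⟨hk, h⟩ := (hΘ k).linear_eq χ τ hτ B hB
    have hr : τ r ∈ K := (hG.mem_iff _).2 ⟨_, hpath r, rfl⟩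
    rw [h]
    have : (⟨_, hk⟩ : K) = ⟨τ r, hr⟩ * k * ⟨τ r, hr⟩⁻¹ := Subtype.ext (by simp [hval])
    have h2 : χ (⟨τ r, hr⟩ * k * ⟨τ r, hr⟩⁻¹) = χ k := by
      rw [map_mul, map_mul, map_inv, mul_right_comm, mul_inv_cancel, one_mul]
    rw [this, h2]
  -- `α ∘ B` differs from the identity by a map that factors through the boundary
  have hαB : α ∘ₗ B = LinearMap.id -
      (Finsupp.linearCombination ℚ pchain) ∘ₗ G.boundary := by
    refine Finsupp.lhom_ext' fun e => LinearMap.ext_ring ?_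
    simp only [LinearMap.comp_apply, LinearMap.sub_apply, Finsupp.lsingle_apply, hB, hα,
      boundary_single, map_sub, LinearMap.id_apply, Finsupp.linearCombination_single, one_smul]
    rw [hΘ_eq _ _ _ (hτ' e) (hτ'' e)]
    abel
  have hαmem : ∀ z, α z ∈ LinearMap.ker G.boundary := fun z => by
    have : G.boundary ∘ₗ α = 0 := by
      refine Finsupp.lhom_ext' fun i => LinearMap.ext_ring ?_
      simp [α, (hΘ (κ i)).boundary]
    exact DFunLike.congr_fun this z
  refine ⟨LinearEquiv.ofLinearMap (B ∘ₗ Submodule.subtype _) (α.codRestrict _ hαmem) ?_ ?_⟩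
  · refine Finsupp.lhom_ext' fun i => LinearMap.ext_ring ?_
    simp [α, hBΘ, hχ]
  · refine LinearMap.ext fun z => Subtype.ext ?_
    have := DFunLike.congr_fun hαB z.1
    simpa [LinearMap.mem_ker.1 z.2] using this

theorem IsStallings.lift_betti {ι : Type w'} (hG : G.IsStallings b r K) (κ : FreeGroupBasis ι K) :
    Cardinal.lift.{w'} G.betti = Cardinal.lift.{max u v} (Cardinal.mk ι) := by
  obtain ⟨e⟩ := hG.nonempty_linearEquiv κ
  have h := e.lift_rank_eq
  rw [rank_finsupp_self] at h
  simpa [betti] using h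

end LabelledGraph

/-! ### Rank of free groups, the Hopf property, and dependence -/

/-- A word in a free group can be detected in a finite permutation group: left multiplication by a
letter is a partial injection on the finite set of values of the suffixes of the word, and a partial
injection of a finite set extends to a permutation. -/
theorem FreeGroup.exists_finite_perm_ne_one {α : Type u} {k : FreeGroup α} (hk : k ≠ 1) :
    ∃ (X : Type u) (_ : Finite X) (π : FreeGroup α →* Equiv.Perm X), π k ≠ 1 := by
  classical
  obtain ⟨w, rfl⟩ : ∃ w, FreeGroup.mk w = k := ⟨k.toWord, FreeGroup.mk_toWord⟩
  let S : Set (FreeGroup α) := FreeGroup.mk '' {v | v ∈ w.tails}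
  have hS : S.Finite := (List.finite_toSet w.tails).image _
  have := hS.fintype
  let e : ∀ a : α, {x : S // FreeGroup.of a * x.1 ∈ S} ≃ {x : S // (FreeGroup.of a)⁻¹ * x.1 ∈ S} :=
    fun a =>
    { toFun := fun x => ⟨⟨_, x.2⟩, by simp⟩
      invFun := fun x => ⟨⟨_, x.2⟩, by simp⟩
      left_inv := fun x => by simp
      right_inv := fun x => by simp }
  let π : FreeGroup α →* Equiv.Perm S := FreeGroup.lift fun a => (e a).extendSubtype
  have h1 : ∀ (a : α) (x : S) (h : FreeGroup.of a * x.1 ∈ S), π (FreeGroup.of a) x = ⟨_, h⟩ := by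
    intro a x h
    rw [FreeGroup.lift_apply_of]
    exact Equiv.extendSubtype_apply_of_mem (e a) x h
  have hmem : ∀ v, v <:+ w → FreeGroup.mk v ∈ S := fun v hv =>
    ⟨v, (List.mem_tails v w).2 hv, rfl⟩
  have key : ∀ v (hv : v <:+ w), π (FreeGroup.mk v) ⟨1, hmem [] (List.nil_suffix)⟩
      = ⟨FreeGroup.mk v, hmem v hv⟩ := by
    intro v
    induction v with
    | nil => intro _; exact congrFun (congrArg _ (_root_.map_one π)) _
    | cons l v ih =>
      intro hv
      have hv' : v <:+ w := (List.suffix_cons l v).trans hv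
      have hl : FreeGroup.mk (l :: v) = FreeGroup.mk [l] * FreeGroup.mk v := by
        rw [FreeGroup.mul_mk]; rfl
      have hl' := hmem _ hv
      rw [hl] at hl'
      have : π (FreeGroup.mk [l]) ⟨FreeGroup.mk v, hmem v hv'⟩ = ⟨_, hl'⟩ := by
        obtain ⟨a, s⟩ := l
        cases s
        · have h2 : FreeGroup.mk [(a, false)] = (FreeGroup.of a)⁻¹ := rfl
          simp only [h2] at hl' ⊢
          rw [_root_.map_inv, Equiv.Perm.inv_eq_iff_eq, h1 a ⟨_, hl'⟩ (by simpa using hmem v hv')]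
          simp
        · exact h1 a _ hl'
      rw [show π (FreeGroup.mk (l :: v)) = π (FreeGroup.mk [l]) * π (FreeGroup.mk v) by
        rw [hl, _root_.map_mul], Equiv.Perm.mul_apply, ih hv', this]
      exact Subtype.ext hl.symm
  refine ⟨S, inferInstance, π, fun h => hk ?_⟩
  have := key w (List.suffix_refl w)
  rw [h] at this
  exact (congrArg Subtype.val this).symm

instance FreeGroup.finite_hom {α : Type*} [Finite α] {M : Type*} [Group M] [Finite M] :
    Finite (FreeGroup α →* M) :=
  Finite.of_equiv _ FreeGroup.lift

/-- Free groups of finite rank are Hopfian. -/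
theorem FreeGroup.injective_of_surjective {α : Type u} [Finite α] {φ : FreeGroup α →* FreeGroup α}
    (hφ : Function.Surjective φ) : Function.Injective φ := by
  rw [injective_iff_map_eq_one]
  intro k hk
  by_contra hne
  obtain ⟨X, _, π, hπ⟩ := FreeGroup.exists_finite_perm_ne_one hne
  -- precomposition with `φ` is injective, hence surjective, on the finite set of homomorphisms
  have hinj : Function.Injective fun ψ : FreeGroup α →* Equiv.Perm X => ψ.comp φ :=
    fun ψ ψ' h => (MonoidHom.cancel_right hφ).1 h
  obtain ⟨ψ, rfl⟩ := Finite.surjective_of_injective hinj π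
  exact hπ (by simp [hk])

theorem FreeGroup.injective_of_surjective_of_embedding {α : Type u} {β : Type w} [Finite α]
    {φ : FreeGroup α →* FreeGroup β} (hφ : Function.Surjective φ) (e : α ↪ β) :
    Function.Injective φ := by
  let s : FreeGroup β →* FreeGroup α := FreeGroup.lift (Function.extend e FreeGroup.of 1)
  have hs : s.comp (FreeGroup.map e) = MonoidHom.id _ := by
    ext a
    simp [s, e.injective.extend_apply]
  have hs' : Function.Surjective s := fun x => ⟨FreeGroup.map e x, DFunLike.congr_fun hs x⟩
  have : Function.Injective (s.comp φ) := FreeGroup.injective_of_surjective (hs'.comp hφ)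
  exact Function.Injective.of_comp this

theorem FreeGroupBasis.finite_of_fg {ι : Type*} {H : Type*} [Group H] [hH : Group.FG H]
    (κ : FreeGroupBasis ι H) : Finite ι := by
  obtain ⟨α, _, φ, hφ⟩ := Group.fg_iff_exists_freeGroup_hom_surjective_finite.1 hH
  let M := Multiplicative (ZMod 2)
  have : Finite (H →* M) := Finite.of_injective (fun ψ : H →* M => ψ.comp φ)
    fun ψ ψ' h => (MonoidHom.cancel_right hφ).1 h
  have : Finite (ι → M) := Finite.of_equiv _ κ.lift.symm
  exact Finite.of_injective (fun i : ι => (Set.mulIndicator {i} (fun _ => .ofAdd 1) : ι → M))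
    fun i j h => by
      by_contra hij
      have := congrFun h i
      simp only [Set.mulIndicator, Set.mem_singleton_iff, hij, if_true, if_false] at this
      exact absurd this (by decide)

/-- The free product of a free group with an infinite cyclic group has one more free generator. -/
noncomputable def coprodUnitEquiv {ι : Type*} {H : Type*} [Group H] (κ : FreeGroupBasis ι H) :
    FreeGroup (Option ι) ≃* Monoid.Coprod H (FreeGroup Unit) :=
  MonoidHom.toMulEquiv
    (FreeGroup.lift fun o => o.elim (Monoid.Coprod.inr (FreeGroup.of ()))
      fun i => Monoid.Coprod.inl (κ i))
    (Monoid.Coprod.lift (κ.lift fun i => FreeGroup.of (some i))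
      (FreeGroup.lift fun _ => FreeGroup.of none))
    (by
      ext o
      cases o <;> simp)
    (by
      refine Monoid.Coprod.hom_ext ?_ ?_
      · exact κ.ext_hom _ _ fun i => by simp
      · ext; simp)

section

variable {F : Type u} [Group F]

theorem range_lift_eq_sup (g : F) (H : Subgroup F) :
    (Monoid.Coprod.lift H.subtype (FreeGroup.lift fun _ : Unit => g)).range =
      H ⊔ Subgroup.zpowers g := by
  rw [Monoid.Coprod.range_lift, H.range_subtype, FreeGroup.range_lift_eq_closure, Set.range_const,
    Subgroup.zpowers_eq_closure]

theorem dependsOnSubgroup_iff_not_injective {g : F} {H : Subgroup F} : DependsOnSubgroup g H ↔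
    ¬ Function.Injective (Monoid.Coprod.lift H.subtype (FreeGroup.lift fun _ : Unit => g)) := by
  rw [injective_iff_map_eq_one, DependsOnSubgroup]
  push Not
  simp only [and_comm]

/-- An element depends on a finitely generated free subgroup if and only if adjoining it does not
raise the rank. -/
theorem dependsOnSubgroup_iff {g : F} {H : Subgroup F} [Group.FG H] {ι ι' : Type w}
    (κ : FreeGroupBasis ι H) (κ' : FreeGroupBasis ι' ↥(H ⊔ Subgroup.zpowers g)) :
    DependsOnSubgroup g H ↔ Cardinal.mk ι' ≤ Cardinal.mk ι := by
  have := κ.finite_of_fg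
  rw [dependsOnSubgroup_iff_not_injective, not_iff_comm, not_le]
  set φ := Monoid.Coprod.lift H.subtype (FreeGroup.lift fun _ : Unit => g)
  let e : φ.range ≃* FreeGroup ι' := (MulEquiv.subgroupCongr (range_lift_eq_sup g H)).trans κ'.repr
  constructor
  · intro hlt
    have h : Cardinal.mk (Option ι) ≤ Cardinal.mk ι' := by
      rw [Cardinal.mk_option]
      exact Cardinal.add_one_le_of_lt hlt
    obtain ⟨f⟩ := Cardinal.le_def _ _ |>.1 h
    have hinj := FreeGroup.injective_of_surjective_of_embedding
      (φ := (e.toMonoidHom.comp φ.rangeRestrict).comp (coprodUnitEquiv κ).toMonoidHom)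
      ((e.surjective.comp φ.rangeRestrict_surjective).comp (coprodUnitEquiv κ).surjective) f
    have h2 : Function.Injective (e ∘ φ.rangeRestrict) :=
      (Function.Injective.of_comp_iff' _ (coprodUnitEquiv κ).bijective).1 hinj
    exact (MonoidHom.injective_codRestrict φ φ.range _).1 (Function.Injective.of_comp h2)
  · intro hinj
    let eq : Option ι ≃ ι' := Equiv.ofFreeGroupEquiv
      ((coprodUnitEquiv κ).trans ((MonoidHom.ofInjective hinj).trans e))
    rw [← Cardinal.mk_congr eq, Cardinal.mk_option]
    have := Fintype.ofFinite ι
    rw [Cardinal.mk_fintype]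
    exact_mod_cast Nat.lt_succ_self _

end

/-! ### Invariant subtrees of the Cayley tree -/

section InvariantTree

variable {A : Type v}

open FreeGroup (IsReduced)

/-- `T` spans a subtree of the Cayley tree of the free group that contains `1` and is invariant
under left translation by `H`. Being connected is expressed by closure under prefixes of reduced
words. -/
structure IsInvariantTree (H : Subgroup (FreeGroup A)) (T : Set (FreeGroup A)) : Prop where
  one_mem : 1 ∈ T
  mul_mem : ∀ h ∈ H, ∀ t ∈ T, h * t ∈ T
  prefix_mem : ∀ v w : List (A × Bool), IsReduced (v ++ w) → FreeGroup.mk (v ++ w) ∈ T →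
    FreeGroup.mk v ∈ T

/-- The reduced word `w` with the letter `l` appended either is reduced, or `l` cancels the last
letter of `w`. -/
theorem isReduced_concat_or {w : List (A × Bool)} (hw : IsReduced w) (l : A × Bool) :
    IsReduced (w ++ [l]) ∨ ∃ v, w = v ++ [(l.1, !l.2)] := by
  rcases List.eq_nil_or_concat' w with rfl | ⟨v, m, rfl⟩
  · exact .inl IsReduced.singleton
  · by_cases h : m.1 = l.1 ∧ m.2 ≠ l.2
    · refine .inr ⟨v, ?_⟩
      obtain ⟨m₁, m₂⟩ := m
      obtain ⟨l₁, l₂⟩ := l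
      obtain ⟨rfl, h⟩ := h
      simp only [ne_eq] at h
      rw [Bool.eq_not.2 h]
    · left
      refine IsReduced.append_overlap hw ?_ (by simp)
      simp only [List.singleton_append, FreeGroup.isReduced_cons_cons]
      exact ⟨by tauto, IsReduced.singleton⟩

theorem mk_concat_not (v : List (A × Bool)) (l : A × Bool) :
    FreeGroup.mk (v ++ [(l.1, !l.2)]) * FreeGroup.mk [l] = FreeGroup.mk v := by
  rw [FreeGroup.mul_mk, List.append_assoc]
  refine Quot.sound ?_
  simpa using FreeGroup.Red.Step.not_rev (L₁ := v) (L₂ := []) (x := l.1) (b := l.2)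

theorem mk_letter_inv (l : A × Bool) : (FreeGroup.mk [l])⁻¹ = FreeGroup.mk [(l.1, !l.2)] := rfl

theorem exists_reduced (f : FreeGroup A) : ∃ w, IsReduced w ∧ FreeGroup.mk w = f := by
  classical
  exact ⟨f.toWord, FreeGroup.isReduced_toWord, FreeGroup.mk_toWord⟩

theorem IsReduced.eq_of_mk_eq {v w : List (A × Bool)} (hv : IsReduced v) (hw : IsReduced w)
    (h : FreeGroup.mk v = FreeGroup.mk w) : v = w := by
  classical
  rw [← hv.reduce_eq, ← hw.reduce_eq, FreeGroup.reduce.sound h]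

/-- `e` is the point at which the geodesic from `1` to `f` leaves `T`. -/
def IsExit (T : Set (FreeGroup A)) (f e : FreeGroup A) : Prop :=
  ∃ (v : List (A × Bool)) (l : A × Bool) (z : List (A × Bool)),
    IsReduced (v ++ l :: z) ∧ FreeGroup.mk (v ++ l :: z) = f ∧ FreeGroup.mk v ∈ T ∧
      FreeGroup.mk (v ++ [l]) = e ∧ e ∉ T

variable {H : Subgroup (FreeGroup A)} {T : Set (FreeGroup A)}

namespace IsInvariantTree

theorem exit_unique (hT : IsInvariantTree H T) {f e e' : FreeGroup A} (h : IsExit T f e)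
    (h' : IsExit T f e') : e = e' := by
  have aux : ∀ {v v' z z' : List (A × Bool)} {l l' : A × Bool}, IsReduced (v' ++ l' :: z') →
      v ++ l :: z = v' ++ l' :: z' → FreeGroup.mk v' ∈ T → FreeGroup.mk (v ++ [l]) ∉ T →
      v'.length ≤ v.length := by
    intro v v' z z' l l' hr heq hv' hv
    by_contra! hlt
    have hpre : v ++ [l] <+: v' := by
      refine List.prefix_of_prefix_length_le (l₃ := v' ++ l' :: z') ?_ ⟨_, rfl⟩ (by simpa using hlt)
      rw [← heq]
      exact ⟨z, by simp⟩
    obtain ⟨y, rfl⟩ := hpre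
    refine hv (hT.prefix_mem _ y (hr.infix ⟨[], l' :: z', by simp⟩) hv')
  obtain ⟨v, l, z, hr, hf, hv, rfl, he⟩ := h
  obtain ⟨v', l', z', hr', hf', hv', rfl, he'⟩ := h'
  have heq := IsReduced.eq_of_mk_eq hr hr' (hf.trans hf'.symm)
  have hlen : v.length = v'.length := le_antisymm (aux hr heq.symm hv he') (aux hr' heq hv' he)
  obtain ⟨rfl, h2⟩ := List.append_inj heq hlen
  rw [(List.cons.inj h2).1]

theorem exit_mul_letter {f e : FreeGroup A} (h : IsExit T f e)
    {l : A × Bool} (hl : f * FreeGroup.mk [l] ∉ T) : IsExit T (f * FreeGroup.mk [l]) e := by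
  obtain ⟨v, m, z, hr, rfl, hv, rfl, he⟩ := h
  rcases isReduced_concat_or hr l with hr' | ⟨y, hy⟩
  · exact ⟨v, m, z ++ [l], by simpa using hr', by simp, hv, rfl, he⟩
  · rw [hy, mk_concat_not] at hl ⊢
    rcases List.eq_nil_or_concat' z with rfl | ⟨z, n, rfl⟩
    · exact absurd ((List.append_inj' hy rfl).1 ▸ hv) hl
    · rw [← List.cons_append, ← List.append_assoc] at hy
      obtain ⟨rfl, -⟩ := List.append_inj' hy rfl
      refine ⟨v, m, z, hr.infix ⟨[], [n], by simp⟩, rfl, hv, rfl, he⟩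

theorem exit_of_exit_mul (hT : IsInvariantTree H T) {g : FreeGroup A} (hg : ∀ t ∈ T, g * t ∉ T)
    {t e : FreeGroup A} (ht : t ∈ T) (h : IsExit T (g * t) e) : IsExit T g e := by
  obtain ⟨w, hw, rfl⟩ := exists_reduced t
  induction w using List.reverseRecOn with
  | nil =>
    have : FreeGroup.mk ([] : List (A × Bool)) = 1 := rfl
    rwa [this, mul_one] at h
  | append_singleton w l ih =>
    have hwT := hT.prefix_mem w [l] hw ht
    have h1 : g * FreeGroup.mk (w ++ [l]) * FreeGroup.mk [(l.1, !l.2)] = g * FreeGroup.mk w := by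
      rw [← mk_letter_inv, ← FreeGroup.mul_mk]; group
    refine ih (hw.infix ⟨[], [l], by simp⟩) hwT ?_
    rw [← h1]
    refine exit_mul_letter h ?_
    rw [h1]
    exact hg _ hwT

theorem exists_exit (hT : IsInvariantTree H T) {f : FreeGroup A} (hf : f ∉ T) :
    ∃ e, IsExit T f e := by
  obtain ⟨w, hw, rfl⟩ := exists_reduced f
  induction w using List.reverseRecOn with
  | nil => exact absurd hT.one_mem hf
  | append_singleton w l ih =>
    by_cases hwT : FreeGroup.mk w ∈ T
    · exact ⟨_, w, l, [], hw, rfl, hwT, rfl, hf⟩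
    · obtain ⟨e, he⟩ := ih (hw.infix ⟨[], [l], by simp⟩) hwT
      refine ⟨e, ?_⟩
      rw [← FreeGroup.mul_mk] at hf ⊢
      exact exit_mul_letter he hf

theorem isReduced_concat (hT : IsInvariantTree H T) {w : List (A × Bool)} {l : A × Bool}
    (hw : IsReduced w) (hwT : FreeGroup.mk w ∈ T) (hl : FreeGroup.mk (w ++ [l]) ∉ T) :
    IsReduced (w ++ [l]) := by
  rcases isReduced_concat_or hw l with h | ⟨v, rfl⟩
  · exact h
  · rw [← FreeGroup.mul_mk, mk_concat_not] at hl
    exact absurd (hT.prefix_mem _ _ hw hwT) hl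

theorem exit_self (hT : IsInvariantTree H T) {s : FreeGroup A} {l : A × Bool} (hs : s ∈ T)
    (hl : s * FreeGroup.mk [l] ∉ T) : IsExit T (s * FreeGroup.mk [l]) (s * FreeGroup.mk [l]) := by
  obtain ⟨w, hw, rfl⟩ := exists_reduced s
  rw [FreeGroup.mul_mk] at hl ⊢
  exact ⟨w, l, [], hT.isReduced_concat hw hs hl, rfl, hs, rfl, hl⟩

/-- An invariant tree remains one when the orbit of an adjacent vertex is added. -/
theorem union_orbit (hT : IsInvariantTree H T) {p : FreeGroup A} {l : A × Bool} (hp : p ∈ T)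
    (hl : p * FreeGroup.mk [l] ∉ T) :
    IsInvariantTree H (T ∪ {f | ∃ h ∈ H, f = h * (p * FreeGroup.mk [l])}) where
  one_mem := .inl hT.one_mem
  mul_mem := by
    rintro h hh t (ht | ⟨h', hh', rfl⟩)
    · exact .inl (hT.mul_mem h hh t ht)
    · exact .inr ⟨h * h', H.mul_mem hh hh', by rw [mul_assoc]⟩
  prefix_mem := by
    rintro v w hr (ht | ⟨h, hh, he⟩)
    · exact .inl (hT.prefix_mem v w hr ht)
    · have hpT := hT.mul_mem h hh p hp
      have hnot : h * p * FreeGroup.mk [l] ∉ T := fun hmem => hl <| by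
        have := hT.mul_mem _ (H.inv_mem hh) _ hmem
        rwa [mul_assoc, inv_mul_cancel_left] at this
      obtain ⟨y, hy, hyp⟩ := exists_reduced (h * p)
      rw [← hyp] at hpT hnot
      rw [FreeGroup.mul_mk] at hnot
      have hred := hT.isReduced_concat hy hpT hnot
      have heq : v ++ w = y ++ [l] := IsReduced.eq_of_mk_eq hr hred (by
        rw [he, ← mul_assoc, ← hyp, FreeGroup.mul_mk])
      rcases List.eq_nil_or_concat' w with rfl | ⟨w, m, rfl⟩
      · right
        rw [List.append_nil] at he
        exact ⟨h, hh, he⟩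
      · left
        rw [← List.append_assoc] at heq
        obtain ⟨rfl, -⟩ := List.append_inj' heq rfl
        exact hT.prefix_mem v w hy hpT

/-- If an invariant tree is disjoint from its translate by `g`, then it can be enlarged until a
single edge separates it from its translate. -/
theorem exists_adjacent {T₀ : Set (FreeGroup A)} (hT₀ : IsInvariantTree H T₀) {g : FreeGroup A}
    (hg₀ : ∀ t ∈ T₀, g * t ∉ T₀) :
    ∃ T, IsInvariantTree H T ∧ (∀ t ∈ T, g * t ∉ T) ∧
      ∃ p ∈ T, ∃ q ∈ T, ∃ l : A × Bool, g = p * FreeGroup.mk [l] * q⁻¹ := by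
  obtain ⟨T, -, hmax⟩ := zorn_subset_nonempty
    {T : Set (FreeGroup A) | IsInvariantTree H T ∧ ∀ t ∈ T, g * t ∉ T} (by
      intro c hc hchain hne
      refine ⟨⋃₀ c, ⟨⟨?_, ?_, ?_⟩, ?_⟩, fun s hs => Set.subset_sUnion_of_mem hs⟩
      · obtain ⟨s, hs⟩ := hne
        exact ⟨s, hs, (hc hs).1.one_mem⟩
      · rintro h hh t ⟨s, hs, ht⟩
        exact ⟨s, hs, (hc hs).1.mul_mem h hh t ht⟩
      · rintro v w hr ⟨s, hs, ht⟩
        exact ⟨s, hs, (hc hs).1.prefix_mem v w hr ht⟩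
      · rintro t ⟨s, hs, ht⟩ ⟨s', hs', ht'⟩
        rcases hchain.total hs hs' with h | h
        · exact (hc hs').2 t (h ht) ht'
        · exact (hc hs).2 t ht (h ht')) T₀ ⟨hT₀, hg₀⟩
  obtain ⟨hT, hg⟩ := hmax.prop
  refine ⟨T, hT, hg, ?_⟩
  have hgT : g ∉ T := by simpa using hg 1 hT.one_mem
  obtain ⟨e, he⟩ := hT.exists_exit hgT
  obtain ⟨v, l, z, -, -, hp, rfl, heT⟩ := id he
  rw [← FreeGroup.mul_mk] at he heT
  set p := FreeGroup.mk v
  by_cases hadj : ∃ q ∈ T, p * FreeGroup.mk [l] = g * q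
  · obtain ⟨q, hq, h⟩ := hadj
    exact ⟨p, hp, q, hq, l, by rw [h, mul_inv_cancel_right]⟩
  -- otherwise the orbit of the exit point can be added to `T`
  have hnot : ∀ h ∈ H, h * (p * FreeGroup.mk [l]) ∉ T := fun h hh hmem => heT <| by
    have := hT.mul_mem _ (H.inv_mem hh) _ hmem
    rwa [inv_mul_cancel_left] at this
  have hbig : T ∪ {f | ∃ h ∈ H, f = h * (p * FreeGroup.mk [l])} ⊆ T := by
    refine hmax.le_of_ge ⟨hT.union_orbit hp heT, ?_⟩ Set.subset_union_left
    rintro t (ht | ⟨h, hh, rfl⟩) (ht' | ⟨h', hh', heq⟩)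
    · exact hg t ht ht'
    · have h1 := hT.exit_self (hT.mul_mem h' hh' p hp) (l := l) (by
        rw [mul_assoc]; exact hnot h' hh')
      rw [mul_assoc, ← heq] at h1
      exact hadj ⟨t, ht, hT.exit_unique he (hT.exit_of_exit_mul hg ht h1)⟩
    · have h2 : g * (h * (p * FreeGroup.mk [l])) * FreeGroup.mk [(l.1, !l.2)] = g * (h * p) := by
        rw [← mk_letter_inv]; group
      have hhp := hT.mul_mem h hh p hp
      have h1 := hT.exit_self ht' (l := (l.1, !l.2)) (by rw [h2]; exact hg _ hhp)
      rw [h2] at h1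
      exact hadj ⟨_, hhp, hT.exit_unique he (hT.exit_of_exit_mul hg hhp h1)⟩
    · rw [← mul_assoc, mul_left_inj] at heq
      have : g = h' * h⁻¹ := by rw [← heq, mul_inv_cancel_right]
      refine hgT ?_
      have := hT.mul_mem g (this ▸ H.mul_mem hh' (H.inv_mem hh)) 1 hT.one_mem
      rwa [mul_one] at this
  exact absurd (hbig (.inr ⟨1, H.one_mem, by rw [one_mul]⟩)) heT

end IsInvariantTree

/-! ### Rerouting one edge of the Schreier graph -/

section Reroute

variable {G : Type w} [Group G] (φ : H →* G)

theorem rightCosetMk_eq_iff {F : Type*} [Group F] {H : Subgroup F} {f f' : F} :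
    rightCosetMk H f = rightCosetMk H f' ↔ f' * f⁻¹ ∈ H :=
  Quotient.eq.trans QuotientGroup.rightRel_apply

/-- The `H`-part of `f`, that is, `f` divided by the chosen representative of its coset. -/
noncomputable def cosetPart (H : Subgroup (FreeGroup A)) (f : FreeGroup A) : H :=
  ⟨f * (rightCosetMk H f).out⁻¹, rightCosetMk_eq_iff.1 (Quotient.out_eq (rightCosetMk H f))⟩

/-- The point of `G × (H \ F)` that is represented by the pair `(γ, f)`, where `(γ φ(h), f)` and
`(γ, h f)` represent the same point. -/
noncomputable def inducedPoint (γ : G) (f : FreeGroup A) : G × RightCosets H :=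
  (γ * φ (cosetPart H f), rightCosetMk H f)

theorem rightCosetMk_mul {F : Type*} [Group F] {H : Subgroup F} (h : H) (f : F) :
    rightCosetMk H (h * f) = rightCosetMk H f := by
  rw [rightCosetMk_eq_iff, mul_inv_rev, mul_inv_cancel_left]
  exact H.inv_mem h.2

theorem inducedPoint_mul (γ : G) (h : H) (f : FreeGroup A) :
    inducedPoint φ γ (h * f) = inducedPoint φ (γ * φ h) f := by
  have : cosetPart H (h * f) = h * cosetPart H f := Subtype.ext (by
    simp [cosetPart, rightCosetMk_mul, mul_assoc])
  rw [inducedPoint, this, rightCosetMk_mul, map_mul, ← mul_assoc, inducedPoint]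

theorem inducedPoint_injective {γ γ' : G} {f : FreeGroup A}
    (h : inducedPoint φ γ f = inducedPoint φ γ' f) : γ = γ' :=
  mul_right_cancel (congrArg Prod.fst h)

theorem inducedPoint_out (x : G × RightCosets H) : inducedPoint φ x.1 x.2.out = x := by
  have h1 : rightCosetMk H x.2.out = x.2 := Quotient.out_eq x.2
  have h2 : cosetPart H x.2.out = 1 := Subtype.ext (by simp [cosetPart, h1])
  rw [inducedPoint, h1, h2, map_one, mul_one]

/-- Right translation by `f` on `G × (H \ F)`, which takes the point represented by `(γ, f')` to the
point represented by `(γ, f' f)`. -/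
noncomputable def inducedMap (f : FreeGroup A) (x : G × RightCosets H) : G × RightCosets H :=
  inducedPoint φ x.1 (x.2.out * f)

theorem inducedMap_inducedPoint (γ : G) (f f' : FreeGroup A) :
    inducedMap φ f (inducedPoint φ γ f') = inducedPoint φ γ (f' * f) := by
  change inducedPoint φ (γ * φ (cosetPart H f')) ((rightCosetMk H f').out * f) = _
  rw [← inducedPoint_mul, ← mul_assoc]
  simp [cosetPart]

/-- Right translation by `f`, as a permutation. -/
noncomputable def inducedPerm (f : FreeGroup A) : Equiv.Perm (G × RightCosets H) where
  toFun := inducedMap φ f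
  invFun := inducedMap φ f⁻¹
  left_inv x := by
    rw [← inducedPoint_out φ x, inducedMap_inducedPoint, inducedMap_inducedPoint,
      mul_inv_cancel_right]
  right_inv x := by
    rw [← inducedPoint_out φ x, inducedMap_inducedPoint, inducedMap_inducedPoint,
      inv_mul_cancel_right]

open Classical in
/-- The exchange of the fibres over the cosets of `u` and `v`, twisted by `y`. -/
noncomputable def twistedSwapFun (u v : FreeGroup A) (y : G) (x : G × RightCosets H) :
    G × RightCosets H :=
  if x.2 = rightCosetMk H u then inducedPoint φ (x.1 * (φ (cosetPart H u))⁻¹ * y) v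
  else if x.2 = rightCosetMk H v then inducedPoint φ (x.1 * (φ (cosetPart H v))⁻¹ * y⁻¹) u
  else x

theorem twistedSwapFun_left (u v : FreeGroup A) (y γ : G) :
    twistedSwapFun φ u v y (inducedPoint φ γ u) = inducedPoint φ (γ * y) v := by
  simp [twistedSwapFun, inducedPoint]

theorem twistedSwapFun_right {u v : FreeGroup A} (huv : rightCosetMk H v ≠ rightCosetMk H u)
    (y γ : G) : twistedSwapFun φ u v y (inducedPoint φ γ v) = inducedPoint φ (γ * y⁻¹) u := by
  simp [twistedSwapFun, inducedPoint, huv]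

theorem twistedSwapFun_involutive {u v : FreeGroup A}
    (huv : rightCosetMk H v ≠ rightCosetMk H u) (y : G) :
    Function.Involutive (twistedSwapFun φ u v y) := by
  rintro ⟨γ, s⟩
  have key : ∀ f, s = rightCosetMk H f →
      (γ, s) = inducedPoint φ (γ * (φ (cosetPart H f))⁻¹) f := by
    rintro f rfl
    simp [inducedPoint]
  by_cases hu : s = rightCosetMk H u
  · rw [key u hu, twistedSwapFun_left, twistedSwapFun_right φ huv, mul_inv_cancel_right]
  by_cases hv : s = rightCosetMk H v
  · rw [key v hv, twistedSwapFun_right φ huv, twistedSwapFun_left, inv_mul_cancel_right]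
  have : twistedSwapFun φ u v y (γ, s) = (γ, s) := by simp [twistedSwapFun, hu, hv]
  rw [this, this]

/-- The free group acts on `G × (H \ F)` in such a way that paths inside `T` are read as in the
Schreier graph, while the letter `a`, read at `p`, leads to `q` and contributes the factor `y`. Here
the action is written so that a word carries the end point of its path back to the initial point. -/
theorem IsInvariantTree.exists_action (hT : IsInvariantTree H T) {p q : FreeGroup A} {a : A}
    (hq : q ∈ T) (hpa : p * FreeGroup.of a ∉ T)
    (hqa : q * (FreeGroup.of a)⁻¹ ∉ T) (y : G) :
    ∃ Φ : FreeGroup A →* Equiv.Perm (G × RightCosets H),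
      (∀ t ∈ T, ∀ γ, Φ t (inducedPoint φ γ t) = inducedPoint φ γ 1) ∧
      ∀ γ, Φ (FreeGroup.of a) (inducedPoint φ (γ * y) q) = inducedPoint φ γ p := by
  classical
  have hcoset : ∀ {f f'}, rightCosetMk H f = rightCosetMk H f' → f ∈ T → f' ∈ T := by
    intro f f' h hf
    have := hT.mul_mem _ (rightCosetMk_eq_iff.1 h) f hf
    rwa [inv_mul_cancel_right] at this
  have huv : rightCosetMk H q ≠ rightCosetMk H (p * FreeGroup.of a) := fun h => hpa (hcoset h hq)
  let swap : Equiv.Perm (G × RightCosets H) := (twistedSwapFun_involutive φ huv y).toPerm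
  let τ : A → Equiv.Perm (G × RightCosets H) := fun d =>
    if d = a then (inducedPerm φ (FreeGroup.of d)).trans swap else inducedPerm φ (FreeGroup.of d)
  let Φ : FreeGroup A →* Equiv.Perm (G × RightCosets H) := FreeGroup.lift fun d => (τ d)⁻¹
  have hΦ : ∀ d, Φ (FreeGroup.of d) = (τ d)⁻¹ := fun d => by simp [Φ]
  have hβ : ∀ d γ f, inducedPerm φ (FreeGroup.of d) (inducedPoint φ γ f) =
      inducedPoint φ γ (f * FreeGroup.of d) := fun d γ f => inducedMap_inducedPoint φ γ _ f
  -- edges of `T` are not affected by the swap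
  have hedge : ∀ d t γ, t ∈ T → t * FreeGroup.of d ∈ T →
      τ d (inducedPoint φ γ t) = inducedPoint φ γ (t * FreeGroup.of d) := by
    intro d t γ ht htd
    by_cases hd : d = a
    · subst hd
      have h1 : rightCosetMk H (t * FreeGroup.of d) ≠ rightCosetMk H (p * FreeGroup.of d) :=
        fun h => hpa (hcoset h htd)
      have h2 : rightCosetMk H (t * FreeGroup.of d) ≠ rightCosetMk H q := fun h => by
        refine hqa (hcoset (f := t) ?_ ht)
        rw [rightCosetMk_eq_iff] at h ⊢
        rwa [mul_inv_rev, ← mul_assoc] at h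
      simp only [τ, if_true, Equiv.trans_apply, hβ]
      change twistedSwapFun φ _ _ y _ = _
      simp [twistedSwapFun, inducedPoint, h1, h2]
    · simp only [τ, hd, if_false, hβ]
  refine ⟨Φ, ?_, fun γ => ?_⟩
  · intro t ht γ
    obtain ⟨w, hw, rfl⟩ := exists_reduced t
    induction w using List.reverseRecOn with
    | nil => exact congrArg (fun σ : Equiv.Perm _ => σ _) (map_one Φ)
    | append_singleton w l ih =>
      have hwT := hT.prefix_mem w [l] hw ht
      rw [← FreeGroup.mul_mk] at ht ⊢
      rw [map_mul, Equiv.Perm.mul_apply]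
      refine (congrArg _ ?_).trans (ih (hw.infix ⟨[], [l], by simp⟩) hwT)
      obtain ⟨d, s⟩ := l
      cases s
      · have hl : FreeGroup.mk [(d, false)] = (FreeGroup.of d)⁻¹ := rfl
        rw [hl] at ht ⊢
        rw [map_inv, hΦ, inv_inv, hedge d _ γ ht (by simpa using hwT), inv_mul_cancel_right]
      · have hl : FreeGroup.mk [(d, true)] = FreeGroup.of d := rfl
        rw [hl] at ht ⊢
        rw [hΦ, Equiv.Perm.inv_eq_iff_eq, hedge d _ γ hwT ht]
  · rw [hΦ, Equiv.Perm.inv_eq_iff_eq]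
    simp only [τ, if_true, Equiv.trans_apply, hβ]
    exact (twistedSwapFun_left φ _ _ y γ).symm

end Reroute

/-- If `g` depends on `H`, then every `H`-invariant tree meets its translate by `g`. -/
theorem IsInvariantTree.exists_mul_mem_of_depends (hT : IsInvariantTree H T) {g : FreeGroup A}
    (hg : DependsOnSubgroup g H) : ∃ t ∈ T, g * t ∈ T := by
  by_contra! hdisj
  obtain ⟨T, hT, hdisj, p, hp, q, hq, l, hgl⟩ := hT.exists_adjacent hdisj
  refine dependsOnSubgroup_iff_not_injective.1 hg ((injective_iff_map_eq_one _).2 fun w hw => ?_)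
  let G := Monoid.Coprod H (FreeGroup Unit)
  let φ : H →* G := Monoid.Coprod.inl
  let y : G := Monoid.Coprod.inr (FreeGroup.of ())
  have hpl : p * FreeGroup.mk [l] ∉ T := by
    rw [show p * FreeGroup.mk [l] = g * q by rw [hgl, inv_mul_cancel_right]]
    exact hdisj q hq
  have hql : q * (FreeGroup.mk [l])⁻¹ ∉ T := fun h => hdisj _ h (by
    rwa [hgl, show p * FreeGroup.mk [l] * q⁻¹ * (q * (FreeGroup.mk [l])⁻¹) = p by group])
  obtain ⟨Φ, hΦ, hΦg⟩ : ∃ Φ : FreeGroup A →* Equiv.Perm (G × RightCosets H),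
      (∀ t ∈ T, ∀ γ, Φ t (inducedPoint φ γ t) = inducedPoint φ γ 1) ∧
      ∀ γ, Φ (FreeGroup.mk [l]) (inducedPoint φ (γ * y) q) = inducedPoint φ γ p := by
    obtain ⟨a, s⟩ := l
    cases s
    · -- the letter `a⁻¹` from `p` to `q` is the letter `a` from `q` to `p`
      have hl : FreeGroup.mk [(a, false)] = (FreeGroup.of a)⁻¹ := rfl
      rw [hl] at hpl hql ⊢
      obtain ⟨Φ, h1, h2⟩ := hT.exists_action φ (p := q) (q := p) (a := a) hp
        (by rwa [inv_inv] at hql) hpl y⁻¹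
      refine ⟨Φ, h1, fun γ => ?_⟩
      rw [map_inv, Equiv.Perm.inv_eq_iff_eq, ← h2, mul_inv_cancel_right]
    · exact hT.exists_action φ hq hpl hql y
  have hone : ∀ h : H, (h : FreeGroup A) ∈ T := fun h => by
    simpa using hT.mul_mem h h.2 1 hT.one_mem
  have hg' : ∀ γ, Φ g (inducedPoint φ (γ * y) 1) = inducedPoint φ γ 1 := fun γ => by
    have h1 : Φ q⁻¹ (inducedPoint φ (γ * y) 1) = inducedPoint φ (γ * y) q := by
      rw [map_inv, Equiv.Perm.inv_eq_iff_eq, hΦ q hq]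
    rw [hgl, map_mul, map_mul, Equiv.Perm.mul_apply, Equiv.Perm.mul_apply, h1, hΦg, hΦ p hp]
  have key : ∀ w γ, Φ (Monoid.Coprod.lift H.subtype (FreeGroup.lift fun _ : Unit => g) w)
      (inducedPoint φ (γ * w) 1) = inducedPoint φ γ 1 := by
    intro w
    induction w using Monoid.Coprod.induction_on with
    | inl h =>
      intro γ
      have := hΦ h (hone h) γ
      have h2 := inducedPoint_mul φ γ h 1
      rw [mul_one] at h2
      rw [h2] at this
      exact this
    | inr n =>
      rw [Monoid.Coprod.lift_apply_inr]
      induction n using FreeGroup.induction_on with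
      | C1 => intro γ; simp
      | of x => intro γ; simpa using hg' γ
      | inv_of x _ =>
        intro γ
        rw [map_inv, map_inv, map_inv, Equiv.Perm.inv_eq_iff_eq, FreeGroup.lift_apply_of]
        have := hg' (γ * y⁻¹)
        rw [inv_mul_cancel_right] at this
        exact this.symm
      | mul x z hx hz =>
        intro γ
        rw [map_mul, map_mul, map_mul, Equiv.Perm.mul_apply, ← mul_assoc, hz, hx]
    | mul x z hx hz =>
      intro γ
      rw [map_mul, map_mul, Equiv.Perm.mul_apply, ← mul_assoc, hz, hx]
  have h1 := key w 1
  rw [hw, map_one, one_mul] at h1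
  exact inducedPoint_injective φ h1

end InvariantTree

/-! ### Dependence under injective homomorphisms and on double cosets -/

section

variable {F : Type u} [Group F]

theorem dependsOnSubgroup_map_iff {F' : Type w} [Group F'] (e : F →* F') {g : F} {H : Subgroup F}
    (he : ∀ x ∈ H ⊔ Subgroup.zpowers g, e x = 1 → x = 1) :
    DependsOnSubgroup (e g) (H.map e) ↔ DependsOnSubgroup g H := by
  let r : H →* H.map e := e.subgroupMap H
  have hr : Function.Bijective r := by
    refine ⟨(injective_iff_map_eq_one _).2 fun x hx => ?_, e.subgroupMap_surjective H⟩
    exact Subtype.ext (he x (Subgroup.mem_sup_left x.2) (congrArg Subtype.val hx))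
  let R : H ≃* H.map e := MulEquiv.ofBijective r hr
  let m : Monoid.Coprod H (FreeGroup Unit) ≃* Monoid.Coprod (H.map e) (FreeGroup Unit) :=
    MulEquiv.coprodCongr R (MulEquiv.refl _)
  have key : (Monoid.Coprod.lift (H.map e).subtype (FreeGroup.lift fun _ : Unit => e g)).comp
      m.toMonoidHom = e.comp (Monoid.Coprod.lift H.subtype (FreeGroup.lift fun _ : Unit => g)) := by
    refine Monoid.Coprod.hom_ext ?_ ?_
    · ext x; rfl
    · ext x; simp [m]
  have key' := DFunLike.congr_fun key
  simp only [MonoidHom.comp_apply, MulEquiv.coe_toMonoidHom] at key'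
  have hrange : ∀ w, Monoid.Coprod.lift H.subtype (FreeGroup.lift fun _ : Unit => g) w ∈
      H ⊔ Subgroup.zpowers g := fun w => range_lift_eq_sup g H ▸ ⟨w, rfl⟩
  constructor
  · rintro ⟨w, hw, h⟩
    obtain ⟨w, rfl⟩ := m.surjective w
    rw [key'] at h
    exact ⟨w, fun h1 => hw (by rw [h1, map_one]), he _ (hrange w) h⟩
  · rintro ⟨w, hw, h⟩
    exact ⟨m w, fun h1 => hw (m.map_eq_one_iff.1 h1), by rw [key', h, map_one]⟩

theorem sup_zpowers_mul_mul (H : Subgroup F) (g : F) {h h' : F} (hh : h ∈ H) (hh' : h' ∈ H) :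
    H ⊔ Subgroup.zpowers (h * g * h') = H ⊔ Subgroup.zpowers g := by
  have hg : g ∈ H ⊔ Subgroup.zpowers g := Subgroup.mem_sup_right (Subgroup.mem_zpowers g)
  have hg' : h * g * h' ∈ H ⊔ Subgroup.zpowers (h * g * h') :=
    Subgroup.mem_sup_right (Subgroup.mem_zpowers _)
  apply le_antisymm <;> refine sup_le le_sup_left ((Subgroup.zpowers_le).2 ?_)
  · exact mul_mem (mul_mem (Subgroup.mem_sup_left hh) hg) (Subgroup.mem_sup_left hh')
  · have := mul_mem (mul_mem (inv_mem (Subgroup.mem_sup_left hh)) hg')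
      (inv_mem (Subgroup.mem_sup_left hh'))
    convert this using 1
    group

/-- Dependence only depends on the subgroup that is generated by adjoining the element. -/
theorem dependsOnSubgroup_congr [IsFreeGroup F] {H : Subgroup F} [Group.FG H] {g g' : F}
    (h : H ⊔ Subgroup.zpowers g = H ⊔ Subgroup.zpowers g') :
    DependsOnSubgroup g H ↔ DependsOnSubgroup g' H := by
  rw [dependsOnSubgroup_iff (IsFreeGroup.basis H) (IsFreeGroup.basis _),
    dependsOnSubgroup_iff (IsFreeGroup.basis H)
      ((IsFreeGroup.basis _).map (MulEquiv.subgroupCongr h))]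

end

namespace LabelledGraph

variable {A : Type v} {F : Type u} [Group F] {b : FreeGroupBasis A F}

/-! ### The tree of a Stallings graph -/

section

variable {V : Type w} {G : LabelledGraph A V} {r : V} {K : Subgroup F}

/-- The words that can be read in a Stallings graph of `K` form a `K`-invariant subtree of the
Cayley tree. -/
theorem IsStallings.isInvariantTree (hG : G.IsStallings b r K) :
    IsInvariantTree (K.map b.repr.toMonoidHom)
      {f | ∃ w y, G.Reads r w y ∧ FreeGroup.mk w = f} where
  one_mem := ⟨[], r, .nil r, rfl⟩
  mul_mem := by
    rintro _ ⟨k, hk, rfl⟩ _ ⟨w, y, hw, rfl⟩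
    obtain ⟨v, hv, rfl⟩ := (hG.mem_iff k).1 hk
    exact ⟨v ++ w, y, hv.append hw, by simp [wordValue]⟩
  prefix_mem := by
    rintro v w hr ⟨w', y, hw', h⟩
    obtain ⟨c, hc, hc'⟩ := FreeGroup.Red.exact.1 h
    obtain rfl := (hr.red_iff_eq).1 hc'
    obtain ⟨z, hz, -⟩ := reads_append_iff.1 (hw'.red hG.det hc)
    exact ⟨v, z, hz, rfl⟩

theorem IsStallings.exists_reads_of_depends (hG : G.IsStallings b r K) {g : F}
    (hg : DependsOnSubgroup g K) : ∃ w w' y y', G.Reads r w y ∧ G.Reads r w' y' ∧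
      g = wordValue b w * (wordValue b w')⁻¹ := by
  obtain ⟨_, ⟨w', y', hw', rfl⟩, w, y, hw, h⟩ := hG.isInvariantTree.exists_mul_mem_of_depends
    ((dependsOnSubgroup_map_iff b.repr.toMonoidHom fun x _ hx =>
      (b.repr.map_eq_one_iff).1 hx).2 hg)
  refine ⟨w, w', y, y', hw, hw', ?_⟩
  rw [eq_mul_inv_iff_mul_eq, wordValue, wordValue, h]
  apply b.repr.injective
  simp

/-! ### Folding a Stallings graph after an identification -/

theorem foldedQuotient_det (G : LabelledGraph A V) (u v : V) :
    (G.foldedQuotient u v).Deterministic := by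
  rintro X ⟨a, s⟩ Y Z hY hZ
  cases s
  · obtain ⟨y, x, rfl, rfl, h⟩ := hY
    obtain ⟨z, x', rfl, hx', h'⟩ := hZ
    exact Quotient.sound (FoldRel.initial h h' (Quotient.exact hx'.symm))
  · obtain ⟨x, y, rfl, rfl, h⟩ := hY
    obtain ⟨x', z, hx', rfl, h'⟩ := hZ
    exact Quotient.sound (FoldRel.terminal h h' (Quotient.exact hx'.symm))

/-- Identifying the end points of two paths at the root and folding yields a Stallings graph of the
group that arises by adjoining the quotient of the two labels. -/
theorem IsStallings.foldedQuotient (hG : G.IsStallings b r K) {u v : V} {wu wv : List (A × Bool)}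
    (hu : G.Reads r wu u) (hv : G.Reads r wv v) :
    (G.foldedQuotient u v).IsStallings b (Quotient.mk _ r)
      (K ⊔ Subgroup.zpowers (wordValue b wu * (wordValue b wv)⁻¹)) := by
  set K' := K ⊔ Subgroup.zpowers (wordValue b wu * (wordValue b wv)⁻¹)
  have hKK' : K ≤ K' := le_sup_left
  have hmono : ∀ {x y w}, G.Reads x w y →
      (G.foldedQuotient u v).Reads (Quotient.mk _ x) w (Quotient.mk _ y) :=
    Reads.mono (G' := G.foldedQuotient u v) (Quotient.mk _)
      fun x a y h => ⟨x, y, rfl, rfl, h⟩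
  have huv : (Quotient.mk (G.foldSetoid u v) u) = Quotient.mk _ v := Quotient.sound FoldRel.ident
  choose path hpath using hG.conn
  let τ : V → F := fun x => wordValue b (path x)
  have hτ : ∀ {x w}, G.Reads r w x → wordValue b w * (τ x)⁻¹ ∈ K := fun h =>
    (hG.mem_iff _).2 ⟨_, h.append (hpath _).invRev, by rw [wordValue_append, wordValue_invRev]⟩
  have hedge : ∀ {x a y}, G.Edge x a y → τ x * b a * (τ y)⁻¹ ∈ K := fun {x a y} h => by
    have := hτ ((hpath x).append (reads_singleton_iff.2 (show G.Step x (a, true) y from h)))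
    rwa [wordValue_append, wordValue_true] at this
  -- related vertices define the same right coset of `K'`
  have hrel : ∀ {x y}, G.FoldRel u v x y → τ x * (τ y)⁻¹ ∈ K' := by
    intro x y h
    induction h with
    | ident =>
      have h1 := hKK' (hτ hu)
      have h2 := hKK' (hτ hv)
      have h3 : wordValue b wu * (wordValue b wv)⁻¹ ∈ K' :=
        Subgroup.mem_sup_right (Subgroup.mem_zpowers _)
      have := mul_mem (mul_mem (inv_mem h1) h3) h2
      convert this using 1
      group
    | refl x => rw [mul_inv_cancel]; exact one_mem _
    | symm _ ih => simpa using inv_mem ih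
    | trans _ _ ih ih' => simpa [mul_assoc] using mul_mem ih ih'
    | terminal h h' _ ih =>
      have := mul_mem (mul_mem (inv_mem (hKK' (hedge h))) ih) (hKK' (hedge h'))
      convert this using 1
      group
    | initial h h' _ ih =>
      have := mul_mem (mul_mem (hKK' (hedge h)) ih) (inv_mem (hKK' (hedge h')))
      convert this using 1
      group
  have hreads : ∀ {X w Y}, (G.foldedQuotient u v).Reads X w Y → ∀ x y, Quotient.mk _ x = X →
      Quotient.mk _ y = Y → τ x * wordValue b w * (τ y)⁻¹ ∈ K' := by
    intro X w Y h
    induction h with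
    | nil X =>
      rintro x y rfl hy
      simpa using hrel (Quotient.exact hy.symm)
    | @cons X Y Z l w h _ ih =>
      rintro x z rfl hz
      have key : ∃ y, Quotient.mk _ y = Y ∧ τ x * wordValue b [l] * (τ y)⁻¹ ∈ K' := by
        obtain ⟨a, s⟩ := l
        cases s
        · obtain ⟨y, x', rfl, hx', h⟩ := h
          refine ⟨y, rfl, ?_⟩
          have := mul_mem (hrel (Quotient.exact hx'.symm)) (inv_mem (hKK' (hedge h)))
          rw [wordValue_false]
          convert this using 1
          group
        · obtain ⟨x', y, hx', rfl, h⟩ := h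
          refine ⟨y, rfl, ?_⟩
          have := mul_mem (hrel (Quotient.exact hx'.symm)) (hKK' (hedge h))
          rw [wordValue_true]
          convert this using 1
          group
      obtain ⟨y, hy, hk⟩ := key
      have := mul_mem hk (ih y z hy hz)
      rw [wordValue_cons]
      convert this using 1
      group
  refine ⟨foldedQuotient_det G u v, ?_, fun k => ⟨fun hk => ?_, ?_⟩⟩
  · rintro ⟨x⟩
    exact ⟨_, hmono (hpath x)⟩
  · refine exists_reads_of_mem_closure (S := (K : Set F) ∪ {wordValue b wu * (wordValue b wv)⁻¹})
      b.repr.symm.toMonoidHom ?_ ?_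
    · rintro g (hg | rfl)
      · obtain ⟨w, hw, rfl⟩ := (hG.mem_iff g).1 hg
        exact ⟨w, hmono hw, rfl⟩
      · have h2 := (hmono hv).invRev
        rw [← huv] at h2
        refine ⟨_, (hmono hu).append h2, ?_⟩
        exact (wordValue_append b _ _).trans (by rw [wordValue_invRev])
    · rwa [Subgroup.closure_union, Subgroup.closure_eq, ← Subgroup.zpowers_eq_closure]
  · rintro ⟨w, hw, rfl⟩
    have h1 := hreads hw r r rfl rfl
    have h2 : τ r ∈ K' := hKK' ((hG.mem_iff _).2 ⟨_, hpath r, rfl⟩)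
    have := mul_mem (mul_mem (inv_mem h2) h1) h2
    convert this using 1
    group

end

/-! ### The Schreier graph and its core -/

section Core

variable {V : Type w} {G : LabelledGraph A V} {r : V}

theorem isReduced_invRev {w : List (A × Bool)} (hw : FreeGroup.IsReduced w) :
    FreeGroup.IsReduced (FreeGroup.invRev w) := by
  classical
  rw [FreeGroup.isReduced_iff_reduce_eq] at hw ⊢
  rw [FreeGroup.reduce_invRev, hw]

theorem mem_coreVerts_root (G : LabelledGraph A V) (r : V) : r ∈ G.coreVerts r :=
  ⟨[], [], FreeGroup.IsReduced.nil, .nil r, .nil r⟩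

theorem core_edge_le {x y : G.coreVerts r} {a : A} (h : (G.core r).Edge x a y) :
    G.Edge x a y := by
  obtain ⟨_, _, -, -, h, -⟩ := h
  exact h

theorem core_reads_le {x y : G.coreVerts r} {w : List (A × Bool)} (h : (G.core r).Reads x w y) :
    G.Reads x w y :=
  h.mono _ fun _ _ _ => core_edge_le

theorem Deterministic.core (hG : G.Deterministic) (r : V) : (G.core r).Deterministic := by
  rintro x ⟨a, s⟩ y z hy hz
  cases s
  · exact Subtype.ext (hG (l := (a, false)) (core_edge_le hy) (core_edge_le hz))
  · exact Subtype.ext (hG (l := (a, true)) (core_edge_le hy) (core_edge_le hz))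

/-- Reduced closed paths at the root stay in the core. -/
theorem core_reads_of_isReduced {x : V} {w₁ w₂ : List (A × Bool)}
    (hr : FreeGroup.IsReduced (w₁ ++ w₂)) (h₁ : G.Reads r w₁ x) (h₂ : G.Reads x w₂ r) :
    ∃ hx : x ∈ G.coreVerts r, (G.core r).Reads ⟨x, hx⟩ w₂ ⟨r, mem_coreVerts_root G r⟩ := by
  refine ⟨⟨w₁, w₂, hr, h₁, h₂⟩, ?_⟩
  induction w₂ generalizing x w₁ with
  | nil =>
    obtain rfl := reads_nil_iff.1 h₂
    exact .nil _
  | cons l w₂ ih =>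
    obtain ⟨y, hl, h₂'⟩ := reads_cons_iff.1 h₂
    have hr' : FreeGroup.IsReduced ((w₁ ++ [l]) ++ w₂) := by simpa using hr
    have h₁' := h₁.append (reads_singleton_iff.2 hl)
    refine .cons (y := ⟨y, w₁ ++ [l], w₂, hr', h₁', h₂'⟩) ?_ (ih hr' h₁' h₂')
    obtain ⟨a, s⟩ := l
    cases s
    · refine ⟨FreeGroup.invRev w₂, FreeGroup.invRev w₁, ?_, h₂'.invRev, hl, h₁.invRev⟩
      have := isReduced_invRev hr
      rwa [FreeGroup.invRev_append, FreeGroup.invRev_cons, List.append_assoc] at this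
    · exact ⟨w₁, w₂, hr, h₁, hl, h₂'⟩

variable (b) (H : Subgroup F)

theorem schreierGraph_step_iff {x y : RightCosets H} {l : A × Bool} :
    (schreierGraph b H).Step x l y ↔
      ∃ g, x = rightCosetMk H g ∧ y = rightCosetMk H (g * wordValue b [l]) := by
  obtain ⟨a, s⟩ := l
  cases s
  · constructor
    · rintro ⟨g, rfl, rfl⟩
      exact ⟨g * b a, rfl, by rw [wordValue_false, mul_inv_cancel_right]⟩
    · rintro ⟨g, rfl, rfl⟩
      exact ⟨g * (b a)⁻¹, by rw [wordValue_false], by rw [inv_mul_cancel_right]⟩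
  · exact Iff.rfl

theorem rightCosetMk_mul_right {g g' : F} (h : rightCosetMk H g = rightCosetMk H g') (f : F) :
    rightCosetMk H (g * f) = rightCosetMk H (g' * f) := by
  rw [rightCosetMk_eq_iff] at h ⊢
  simpa [mul_assoc] using h

theorem schreierGraph_det : (schreierGraph b H).Deterministic := by
  intro x l y z hy hz
  rw [schreierGraph_step_iff] at hy hz
  obtain ⟨g, rfl, rfl⟩ := hy
  obtain ⟨g', h, rfl⟩ := hz
  exact rightCosetMk_mul_right H h _

theorem schreierGraph_reads_iff {g : F} {w : List (A × Bool)} {y : RightCosets H} :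
    (schreierGraph b H).Reads (rightCosetMk H g) w y ↔
      y = rightCosetMk H (g * wordValue b w) := by
  have key : (schreierGraph b H).Reads (rightCosetMk H g) w
      (rightCosetMk H (g * wordValue b w)) := by
    induction w generalizing g with
    | nil => simpa using Reads.nil _
    | cons l w ih =>
      rw [wordValue_cons, ← mul_assoc]
      exact .cons ((schreierGraph_step_iff b H).2 ⟨g, rfl, rfl⟩) ih
  exact ⟨fun h => h.unique (schreierGraph_det b H) key, by rintro rfl; exact key⟩

theorem schreierGraph_loop_iff {w : List (A × Bool)} :
    (schreierGraph b H).Reads (rightCosetMk H 1) w (rightCosetMk H 1) ↔ wordValue b w ∈ H := by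
  rw [schreierGraph_reads_iff, one_mul, rightCosetMk_eq_iff, inv_one, mul_one]

/-- The root of the core graph. -/
def coreRoot : CoreVertex b H := ⟨rightCosetMk H 1, mem_coreVerts_root _ _⟩

theorem coreGraph_isStallings : (coreGraph b H).IsStallings b (coreRoot b H) H where
  det := (schreierGraph_det b H).core _
  conn := by
    rintro ⟨x, w₁, w₂, hr, h₁, h₂⟩
    obtain ⟨_, h⟩ := core_reads_of_isReduced (w₁ := []) hr (.nil _) (h₁.append h₂)
    obtain ⟨y, hy, -⟩ := reads_append_iff.1 h
    have : y.1 = x := (core_reads_le hy).unique (schreierGraph_det b H) h₁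
    subst this
    exact ⟨w₁, hy⟩
  mem_iff := by
    intro k
    constructor
    · intro hk
      obtain ⟨w, hw, hk'⟩ := exists_reduced (b.repr k)
      have hval : wordValue b w = k := by rw [wordValue, hk', MulEquiv.symm_apply_apply]
      obtain ⟨_, h⟩ := core_reads_of_isReduced (w₁ := []) (w₂ := w) hw (.nil _)
        ((schreierGraph_loop_iff b H).2 (hval ▸ hk))
      exact ⟨w, h, hval⟩
    · rintro ⟨w, hw, rfl⟩
      exact (schreierGraph_loop_iff b H).1 (core_reads_le hw)

end Core

/-! ### The graph of the prefixes of generating words -/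

section PrefixGraph

/-- The prefixes of a list of words; the empty word is included even if the list is empty. -/
def prefixes {α : Type*} (L : List (List α)) : List (List α) := [] :: L.flatMap List.inits

theorem mem_prefixes {α : Type*} {L : List (List α)} {p : List α} :
    p ∈ prefixes L ↔ p = [] ∨ ∃ w ∈ L, p <+: w := by
  simp [prefixes]

theorem prefixes_of_append {α : Type*} {L : List (List α)} {p q : List α}
    (h : p ++ q ∈ prefixes L) : p ∈ prefixes L := by
  rw [mem_prefixes] at h ⊢
  rcases h with h | ⟨w, hw, h⟩
  · exact .inl (List.append_eq_nil_iff.1 h).1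
  · exact .inr ⟨w, hw, (List.prefix_append p q).trans h⟩

variable (b) (H : Subgroup F) (L : List (List (A × Bool)))

/-- The vertices of the prefix graph: the cosets that are represented by prefixes. -/
abbrev PrefixVertex : Type u :=
  {x : RightCosets H // ∃ p ∈ prefixes L, x = rightCosetMk H (wordValue b p)}

/-- The subgraph of the Schreier graph that is traversed by the paths at the root which are labelled
by the words in `L`. -/
def prefixGraph : LabelledGraph A (PrefixVertex b H L) where
  Edge x a y :=
    (∃ p, p ++ [(a, true)] ∈ prefixes L ∧ x.1 = rightCosetMk H (wordValue b p) ∧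
      y.1 = rightCosetMk H (wordValue b (p ++ [(a, true)]))) ∨
    (∃ p, p ++ [(a, false)] ∈ prefixes L ∧ x.1 = rightCosetMk H (wordValue b (p ++ [(a, false)])) ∧
      y.1 = rightCosetMk H (wordValue b p))

/-- The root of the prefix graph. -/
def prefixRoot : PrefixVertex b H L :=
  ⟨rightCosetMk H 1, [], mem_prefixes.2 (.inl rfl), by rw [wordValue_nil]⟩

theorem prefixGraph_edge_le {x y : PrefixVertex b H L} {a : A}
    (h : (prefixGraph b H L).Edge x a y) : (schreierGraph b H).Edge x a y := by
  rcases h with ⟨p, -, hx, hy⟩ | ⟨p, -, hx, hy⟩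
  · exact ⟨_, hx, by rw [hy, wordValue_append, wordValue_true]⟩
  · exact ⟨_, hx, by rw [hy, wordValue_append, wordValue_false, inv_mul_cancel_right]⟩

theorem prefixGraph_reads_le {x y : PrefixVertex b H L} {w : List (A × Bool)}
    (h : (prefixGraph b H L).Reads x w y) : (schreierGraph b H).Reads x w y :=
  h.mono _ fun _ _ _ => prefixGraph_edge_le b H L

theorem prefixGraph_reads {p : List (A × Bool)} (hp : p ∈ prefixes L) :
    (prefixGraph b H L).Reads (prefixRoot b H L) p
      ⟨rightCosetMk H (wordValue b p), p, hp, rfl⟩ := by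
  induction p using List.reverseRecOn with
  | nil => exact reads_nil_iff.2 (Subtype.ext (by simp [prefixRoot]))
  | append_singleton p l ih =>
    refine (ih (prefixes_of_append hp)).append (reads_singleton_iff.2 ?_)
    obtain ⟨a, s⟩ := l
    cases s
    · exact .inr ⟨p, hp, rfl, rfl⟩
    · exact .inl ⟨p, hp, rfl, rfl⟩

theorem prefixGraph_isStallings (hL : Subgroup.closure {g | ∃ w ∈ L, wordValue b w = g} = H) :
    (prefixGraph b H L).IsStallings b (prefixRoot b H L) H where
  det := by
    rintro x ⟨a, s⟩ y z hy hz
    cases s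
    · exact Subtype.ext (schreierGraph_det b H (l := (a, false))
        (prefixGraph_edge_le b H L hy) (prefixGraph_edge_le b H L hz))
    · exact Subtype.ext (schreierGraph_det b H (l := (a, true))
        (prefixGraph_edge_le b H L hy) (prefixGraph_edge_le b H L hz))
  conn := by
    rintro ⟨x, p, hp, rfl⟩
    exact ⟨p, prefixGraph_reads b H L hp⟩
  mem_iff := by
    intro k
    constructor
    · intro hk
      rw [← hL] at hk
      refine exists_reads_of_mem_closure b.repr.symm.toMonoidHom ?_ hk
      rintro g ⟨w, hw, rfl⟩
      have hr := prefixGraph_reads b H L (mem_prefixes.2 (.inr ⟨w, hw, List.prefix_rfl⟩))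
      refine ⟨w, ?_, rfl⟩
      convert hr using 1
      refine Subtype.ext (rightCosetMk_eq_iff.2 ?_)
      rw [inv_one, mul_one, ← hL]
      exact Subgroup.subset_closure ⟨w, hw, rfl⟩
    · rintro ⟨w, hw, rfl⟩
      exact (schreierGraph_loop_iff b H).1 (prefixGraph_reads_le b H L hw)

instance finite_prefixVertex : Finite (PrefixVertex b H L) := by
  refine Set.Finite.to_subtype (((prefixes L).finite_toSet.image
    fun p => rightCosetMk H (wordValue b p)).subset ?_)
  rintro x ⟨p, hp, rfl⟩
  exact ⟨p, hp, rfl⟩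

variable {H}

theorem exists_words_of_fg (hH : H.FG) :
    ∃ L : List (List (A × Bool)), Subgroup.closure {g | ∃ w ∈ L, wordValue b w = g} = H := by
  classical
  obtain ⟨S, rfl⟩ := hH
  refine ⟨S.toList.map fun s => (b.repr s).toWord, ?_⟩
  congr 1
  ext g
  simp [wordValue, FreeGroup.mk_toWord]

/-- The core is contained in the prefix graph: a reduced closed path at the root arises from a
closed path in the prefix graph by free reduction. -/
theorem finite_coreVertex (hH : H.FG) : Finite (CoreVertex b H) := by
  obtain ⟨L, hL⟩ := exists_words_of_fg b hH
  have hst := prefixGraph_isStallings b H L hL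
  refine Set.Finite.subset (Set.finite_range (Subtype.val : PrefixVertex b H L → _)) ?_
  rintro x ⟨w₁, w₂, hr, h₁, h₂⟩
  obtain ⟨w, hw, hval⟩ := (hst.mem_iff _).1 ((schreierGraph_loop_iff b H).1 (h₁.append h₂))
  obtain ⟨c, hc, hc'⟩ := FreeGroup.Red.exact.1 ((wordValue_inj b).1 hval)
  obtain rfl := hr.red_iff_eq.1 hc'
  obtain ⟨y, hy, -⟩ := reads_append_iff.1 (hw.red hst.det hc)
  exact ⟨y, (prefixGraph_reads_le b H L hy).unique (schreierGraph_det b H) h₁⟩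

end PrefixGraph

/-! ### Dependent elements and pairs of core vertices -/

section Pairs

variable {H : Subgroup F}

theorem mem_nonRaisingPairs_iff (hH : H.FG) {rep : CoreVertex b H → F}
    (hrep : ∀ x : CoreVertex b H, rightCosetMk H (rep x) = x)
    (p : CoreVertex b H × CoreVertex b H) :
    p ∈ nonRaisingPairs b H ↔ DependsOnSubgroup (rep p.1 * (rep p.2)⁻¹) H := by
  have := b.isFreeGroup
  have : Group.FG H := (Group.fg_iff_subgroup_fg H).2 hH
  have hst := coreGraph_isStallings b H
  obtain ⟨wu, hu⟩ := hst.conn p.1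
  obtain ⟨wv, hv⟩ := hst.conn p.2
  have hcos : ∀ {x : CoreVertex b H} {w}, (coreGraph b H).Reads (coreRoot b H) w x →
      wordValue b w * (rep x)⁻¹ ∈ H := fun {x w} h => by
    have := (schreierGraph_reads_iff b H).1 (core_reads_le h)
    rw [← hrep, one_mul] at this
    exact rightCosetMk_eq_iff.1 this
  have hsup := sup_zpowers_mul_mul H (rep p.1 * (rep p.2)⁻¹) (hcos hu) (inv_mem (hcos hv))
  rw [show wordValue b wu * (rep p.1)⁻¹ * (rep p.1 * (rep p.2)⁻¹) *
    (wordValue b wv * (rep p.2)⁻¹)⁻¹ = wordValue b wu * (wordValue b wv)⁻¹ by group] at hsup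
  rw [← dependsOnSubgroup_congr hsup,
    dependsOnSubgroup_iff (IsFreeGroup.basis H) (IsFreeGroup.basis _)]
  have h1 := hst.lift_betti (IsFreeGroup.basis H)
  have h2 := (hst.foldedQuotient hu hv).lift_betti (IsFreeGroup.basis _)
  change ((coreGraph b H).foldedQuotient p.1 p.2).betti ≤ (coreGraph b H).betti ↔ _
  rw [← Cardinal.lift_le.{u}, h1, h2, Cardinal.lift_le]

theorem finite_nonRaisingPairs (hH : H.FG) : (nonRaisingPairs b H).Finite := by
  have := finite_coreVertex b hH
  exact Set.toFinite _

theorem dependentSet_eq_iUnion (hH : H.FG) {rep : CoreVertex b H → F}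
    (hrep : ∀ x : CoreVertex b H, rightCosetMk H (rep x) = x) :
    dependentSet H = ⋃ p ∈ nonRaisingPairs b H,
      DoubleCoset.doubleCoset (rep p.1 * (rep p.2)⁻¹) (H : Set F) (H : Set F) := by
  have := b.isFreeGroup
  have : Group.FG H := (Group.fg_iff_subgroup_fg H).2 hH
  have hst := coreGraph_isStallings b H
  ext g
  simp only [Set.mem_iUnion, DoubleCoset.mem_doubleCoset, exists_prop]
  constructor
  · intro hg
    obtain ⟨w, w', y, y', hw, hw', rfl⟩ := hst.exists_reads_of_depends hg
    have hcos : ∀ {x : CoreVertex b H} {w}, (coreGraph b H).Reads (coreRoot b H) w x →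
        wordValue b w * (rep x)⁻¹ ∈ H := fun {x w} h => by
      have := (schreierGraph_reads_iff b H).1 (core_reads_le h)
      rw [← hrep, one_mul] at this
      exact rightCosetMk_eq_iff.1 this
    have heq : wordValue b w * (wordValue b w')⁻¹ = wordValue b w * (rep y)⁻¹ *
        (rep y * (rep y')⁻¹) * (wordValue b w' * (rep y')⁻¹)⁻¹ := by group
    refine ⟨(y, y'), (mem_nonRaisingPairs_iff hH hrep _).2 ?_, _, hcos hw, _,
      inv_mem (hcos hw'), heq⟩
    refine (dependsOnSubgroup_congr (sup_zpowers_mul_mul H _ (hcos hw) (inv_mem (hcos hw')))).1 ?_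
    rwa [← heq]
  · rintro ⟨p, hp, h, hh, h', hh', rfl⟩
    exact (dependsOnSubgroup_congr (sup_zpowers_mul_mul H _ hh hh')).2
      ((mem_nonRaisingPairs_iff hH hrep p).1 hp)

theorem one_mem_dependentSet (H : Subgroup F) : (1 : F) ∈ dependentSet H := by
  refine ⟨Monoid.Coprod.inr (FreeGroup.of ()), fun h => ?_, by simp⟩
  have := congrArg (Monoid.Coprod.snd : Monoid.Coprod H (FreeGroup Unit) →* _) h
  rw [Monoid.Coprod.snd_apply_inr, map_one] at this
  exact FreeGroup.of_ne_one () this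

theorem le_dependentSubgroup [IsFreeGroup F] [Group.FG H] : H ≤ dependentSubgroup H := by
  intro h hh
  refine Subgroup.subset_closure ((dependsOnSubgroup_congr ?_).1 (one_mem_dependentSet H))
  simpa using (sup_zpowers_mul_mul H 1 hh H.one_mem).symm

theorem dependentSubgroup_eq_closure (hH : H.FG) {rep : CoreVertex b H → F}
    (hrep : ∀ x : CoreVertex b H, rightCosetMk H (rep x) = x) :
    dependentSubgroup H = Subgroup.closure ((H : Set F) ∪
      {g | ∃ p ∈ nonRaisingPairs b H, g = rep p.1 * (rep p.2)⁻¹}) := by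
  have := b.isFreeGroup
  have : Group.FG H := (Group.fg_iff_subgroup_fg H).2 hH
  apply le_antisymm
  · rw [dependentSubgroup, Subgroup.closure_le, dependentSet_eq_iUnion hH hrep]
    intro g hg
    simp only [Set.mem_iUnion, DoubleCoset.mem_doubleCoset, exists_prop] at hg
    obtain ⟨p, hp, h, hh, h', hh', rfl⟩ := hg
    exact mul_mem (mul_mem (Subgroup.subset_closure (.inl hh))
      (Subgroup.subset_closure (.inr ⟨p, hp, rfl⟩))) (Subgroup.subset_closure (.inl hh'))
  · rw [Subgroup.closure_le]
    rintro g (hg | ⟨p, hp, rfl⟩)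
    · exact le_dependentSubgroup hg
    · exact Subgroup.subset_closure ((mem_nonRaisingPairs_iff hH hrep p).1 hp)

end Pairs

end LabelledGraph

namespace LabelledGraph

/-! ### The rank of a finite Stallings graph -/

section Euler

variable {A : Type u} {V : Type v} {G : LabelledGraph A V} {F : Type w} [Group F]
  {b : FreeGroupBasis A F} {r : V} {K : Subgroup F}

/-- For a finite Stallings graph of `K`, the rank of `K` is given by the Euler characteristic. -/
theorem IsStallings.card_add_card [Finite V] [Finite G.Edges] (hG : G.IsStallings b r K)
    {ι : Type w'} (κ : FreeGroupBasis ι K) :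
    Nat.card ι + Nat.card V = Nat.card G.Edges + 1 := by
  obtain ⟨e⟩ := hG.nonempty_linearEquiv κ
  have := Fintype.ofFinite V
  have := Fintype.ofFinite G.Edges
  have hker : Module.finrank ℚ (LinearMap.ker G.boundary) = Nat.card ι := by
    rw [e.finrank_eq, Module.finrank, rank_finsupp_self, Cardinal.toNat_lift, Nat.card]
  -- the image of the boundary map is the kernel of the augmentation
  let ε : (V →₀ ℚ) →ₗ[ℚ] ℚ := Finsupp.linearCombination ℚ fun _ => 1
  choose path hpath using hG.conn
  choose pchain hpchain using fun x => (hpath x).exists_traces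
  have h1 : ε ∘ₗ G.boundary = 0 := by
    refine Finsupp.lhom_ext' fun e => LinearMap.ext_ring ?_
    simp [boundary_single, ε]
  have h2 : G.boundary ∘ₗ Finsupp.linearCombination ℚ pchain =
      LinearMap.id - (LinearMap.toSpanSingleton ℚ _ (Finsupp.single r 1)) ∘ₗ ε := by
    refine Finsupp.lhom_ext' fun x => LinearMap.ext_ring ?_
    simp [ε, (hpchain x).boundary]
  have hrange : LinearMap.range G.boundary = LinearMap.ker ε := by
    apply le_antisymm
    · rintro _ ⟨c, rfl⟩
      exact DFunLike.congr_fun h1 c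
    · intro z hz
      refine ⟨Finsupp.linearCombination ℚ pchain z, ?_⟩
      have := DFunLike.congr_fun h2 z
      simpa [LinearMap.mem_ker.1 hz] using this
  have hε : LinearMap.range ε = ⊤ :=
    LinearMap.range_eq_top.2 fun q => ⟨Finsupp.single r q, by simp [ε]⟩
  have hd1 := LinearMap.finrank_range_add_finrank_ker G.boundary
  have hd2 := LinearMap.finrank_range_add_finrank_ker ε
  rw [hrange, hker, Module.finrank_finsupp_self] at hd1
  rw [hε, finrank_top, Module.finrank_self, Module.finrank_finsupp_self] at hd2
  simp only [Nat.card_eq_fintype_card] at *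
  omega

end Euler

end LabelledGraph

/-! ### Deciding whether two prefixes represent the same coset -/

section Algorithm

open LabelledGraph

/-- Words in the letters `0, 1, 2, …` and their inverses. -/
abbrev Word : Type := List (ℕ × Bool)

/-- The subgroup of the free group on the letters that is generated by a list of words. -/
def wordSubgroup (L : List Word) : Subgroup (FreeGroup ℕ) :=
  Subgroup.closure {g | ∃ w ∈ L, FreeGroup.mk w = g}

/-- All ordered pairs from a list. -/
def listPairs {α : Type*} (U : List α) : List (α × α) := U.flatMap fun u => U.map fun v => (u, v)

theorem mem_listPairs {α : Type*} {U : List α} {p : α × α} :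
    p ∈ listPairs U ↔ p.1 ∈ U ∧ p.2 ∈ U := by
  obtain ⟨u, v⟩ := p
  simp [listPairs]

/-- The letters that occur in a list of words, and their inverses. -/
def signedLetters (L : List Word) : Word := L.flatten.flatMap fun l => [l, (l.1, !l.2)]

/-- The row of `u` in the relation `S`. Two prefixes are regarded as identified by `S` if they have
the same row, which makes this an equivalence relation for every `S`. -/
def rowOf (L : List Word) (S : List (Word × Word)) (u : Word) : List Word :=
  (prefixes L).filter fun v => decide ((u, v) ∈ S)

/-- The letter `l` leads from the prefix `e.1` to the prefix `e.2`. -/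
def isWordStep (l : ℕ × Bool) (e : Word × Word) : Bool :=
  decide (e.2 = e.1 ++ [l]) || decide (e.1 = e.2 ++ [(l.1, !l.2)])

/-- If the identifications made by `S` identify the initial vertices of the steps `e` and `e'`, both
with label `l`, then they identify the terminal vertices as well. -/
def foldCondition (L : List Word) (S : List (Word × Word)) (e e' : Word × Word) (l : ℕ × Bool) :
    Bool :=
  !(decide (rowOf L S e.1 = rowOf L S e'.1) && isWordStep l e && isWordStep l e') ||
    decide (rowOf L S e.2 = rowOf L S e'.2)

/-- The identifications made by `S` close up the words in `L` and are stable under folding. -/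
def isFolded (L : List Word) (S : List (Word × Word)) : Bool :=
  (L.all fun w => decide (rowOf L S w = rowOf L S [])) &&
  (listPairs (prefixes L)).all fun e => (listPairs (prefixes L)).all fun e' =>
    (signedLetters L).all fun l => foldCondition L S e e' l

/-- Two prefixes are identified by every folded relation. -/
def sameCoset (L : List Word) (u v : Word) : Bool :=
  (listPairs (prefixes L)).sublists'.all fun S =>
    !isFolded L S || decide (rowOf L S u = rowOf L S v)

theorem isFolded_iff {L : List Word} {S : List (Word × Word)} : isFolded L S = true ↔
    (∀ w ∈ L, rowOf L S w = rowOf L S []) ∧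
    ∀ l ∈ signedLetters L, ∀ x ∈ prefixes L, ∀ y ∈ prefixes L, ∀ x' ∈ prefixes L,
      ∀ y' ∈ prefixes L, rowOf L S x = rowOf L S x' → isWordStep l (x, y) = true →
        isWordStep l (x', y') = true → rowOf L S y = rowOf L S y' := by
  simp only [isFolded, foldCondition, Bool.and_eq_true, List.all_eq_true, decide_eq_true_eq,
    Bool.or_eq_true, Bool.not_eq_true']
  refine and_congr_right fun _ => ⟨fun h l hl x hx y hy x' hx' y' hy' h1 h2 h3 => ?_,
    fun h e he e' he' l hl => ?_⟩
  · have := h (x, y) (mem_listPairs.2 ⟨hx, hy⟩) (x', y') (mem_listPairs.2 ⟨hx', hy'⟩) l hl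
    simpa [h1, h2, h3] using this
  · rw [mem_listPairs] at he he'
    have := h l hl _ he.1 _ he.2 _ he'.1 _ he'.2
    by_cases h1 : rowOf L S e.1 = rowOf L S e'.1 <;> by_cases h2 : isWordStep l e = true <;>
      by_cases h3 : isWordStep l e' = true <;> simp_all

theorem mem_signedLetters_of_concat {L : List Word} {p : Word} {l : ℕ × Bool}
    (h : p ++ [l] ∈ prefixes L) : l ∈ signedLetters L ∧ (l.1, !l.2) ∈ signedLetters L := by
  rcases mem_prefixes.1 h with h | ⟨w, hw, h⟩
  · simp at h
  · have hl : l ∈ L.flatten := List.mem_flatten.2 ⟨w, hw, h.subset (by simp)⟩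
    exact ⟨List.mem_flatMap.2 ⟨l, hl, by simp⟩, List.mem_flatMap.2 ⟨l, hl, by simp⟩⟩

theorem mem_signedLetters_of_step {L : List Word} {x y : Word} {l : ℕ × Bool}
    (hx : x ∈ prefixes L) (hy : y ∈ prefixes L) (h : isWordStep l (x, y) = true) :
    l ∈ signedLetters L := by
  simp only [isWordStep, Bool.or_eq_true, decide_eq_true_eq] at h
  rcases h with rfl | rfl
  · exact (mem_signedLetters_of_concat hy).1
  · simpa using (mem_signedLetters_of_concat hx).2

theorem isWordStep_not {l : ℕ × Bool} {x y : Word} :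
    isWordStep (l.1, !l.2) (y, x) = isWordStep l (x, y) := by
  simp [isWordStep, Bool.or_comm]

/-- The graph obtained from the paths labelled by the words in `L` by identifying prefixes with the
same row; its vertices are the rows. -/
def rowGraph (L : List Word) (S : List (Word × Word)) : LabelledGraph ℕ (List Word) where
  Edge ρ a σ := ∃ x ∈ prefixes L, ∃ y ∈ prefixes L, isWordStep (a, true) (x, y) = true ∧
    ρ = rowOf L S x ∧ σ = rowOf L S y

theorem rowGraph_step_iff {L : List Word} {S : List (Word × Word)} {ρ σ : List Word}
    {l : ℕ × Bool} : (rowGraph L S).Step ρ l σ ↔ ∃ x ∈ prefixes L, ∃ y ∈ prefixes L,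
      isWordStep l (x, y) = true ∧ ρ = rowOf L S x ∧ σ = rowOf L S y := by
  obtain ⟨a, s⟩ := l
  cases s
  · constructor
    · rintro ⟨x, hx, y, hy, h, rfl, rfl⟩
      exact ⟨y, hy, x, hx, isWordStep_not (l := (a, true)) ▸ h, rfl, rfl⟩
    · rintro ⟨x, hx, y, hy, h, rfl, rfl⟩
      exact ⟨y, hy, x, hx, isWordStep_not (l := (a, false)) ▸ h, rfl, rfl⟩
  · exact Iff.rfl

theorem rowGraph_reads {L : List Word} {S : List (Word × Word)} {p : Word}
    (hp : p ∈ prefixes L) : (rowGraph L S).Reads (rowOf L S []) p (rowOf L S p) := by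
  induction p using List.reverseRecOn with
  | nil => exact .nil _
  | append_singleton p l ih =>
    have hp' := prefixes_of_append hp
    refine (ih hp').append (reads_singleton_iff.2 (rowGraph_step_iff.2 ?_))
    exact ⟨p, hp', _, hp, by simp [isWordStep], rfl, rfl⟩

theorem rowGraph_det {L : List Word} {S : List (Word × Word)} (hS : isFolded L S = true) :
    (rowGraph L S).Deterministic := by
  intro ρ l σ σ' h h'
  rw [rowGraph_step_iff] at h h'
  obtain ⟨x, hx, y, hy, h, rfl, rfl⟩ := h
  obtain ⟨x', hx', y', hy', h', heq, rfl⟩ := h'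
  exact (isFolded_iff.1 hS).2 l (mem_signedLetters_of_step hx hy h) x hx y hy x' hx' y' hy' heq h h'

theorem wordStep_mk {l : ℕ × Bool} {x y : Word} (h : isWordStep l (x, y) = true) :
    FreeGroup.mk y = FreeGroup.mk x * FreeGroup.mk [l] := by
  simp only [isWordStep, Bool.or_eq_true, decide_eq_true_eq] at h
  rcases h with rfl | rfl
  · rw [FreeGroup.mul_mk]
  · rw [mk_concat_not]

theorem sameCoset_iff {L : List Word} {u v : Word} (hu : u ∈ prefixes L) (hv : v ∈ prefixes L) :
    sameCoset L u v = true ↔ rightCosetMk (wordSubgroup L) (FreeGroup.mk u) =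
      rightCosetMk (wordSubgroup L) (FreeGroup.mk v) := by
  classical
  have key : sameCoset L u v = true ↔ ∀ S, S.Sublist (listPairs (prefixes L)) →
      isFolded L S = true → rowOf L S u = rowOf L S v := by
    simp only [sameCoset, List.all_eq_true, List.mem_sublists', Bool.or_eq_true,
      decide_eq_true_eq, Bool.not_eq_true']
    refine forall_congr' fun S => forall_congr' fun _ => ?_
    cases isFolded L S <;> simp
  rw [key]
  constructor
  · intro h
    -- the coset relation itself is folded
    let R : List (Word × Word) := (listPairs (prefixes L)).filter fun e =>
      decide (rightCosetMk (wordSubgroup L) (FreeGroup.mk e.1) =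
        rightCosetMk (wordSubgroup L) (FreeGroup.mk e.2))
    have hmem : ∀ {x y}, x ∈ prefixes L → (y ∈ rowOf L R x ↔ y ∈ prefixes L ∧
        rightCosetMk (wordSubgroup L) (FreeGroup.mk x) =
          rightCosetMk (wordSubgroup L) (FreeGroup.mk y)) := by
      intro x y hx
      simp only [rowOf, R, List.mem_filter, mem_listPairs, decide_eq_true_eq]
      tauto
    have hrow : ∀ {x y}, x ∈ prefixes L → y ∈ prefixes L → (rowOf L R x = rowOf L R y ↔
        rightCosetMk (wordSubgroup L) (FreeGroup.mk x) =
          rightCosetMk (wordSubgroup L) (FreeGroup.mk y)) := by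
      intro x y hx hy
      constructor
      · intro h
        have h1 : y ∈ rowOf L R y := (hmem hy).2 ⟨hy, rfl⟩
        rw [← h] at h1
        exact ((hmem hx).1 h1).2
      · intro h
        refine List.filter_congr fun z hz => ?_
        simp only [R, List.mem_filter, mem_listPairs, decide_eq_true_eq, h, hx, hy, hz]
    refine (hrow hu hv).1 (h R List.filter_sublist (isFolded_iff.2 ⟨fun w hw => ?_, ?_⟩))
    · rw [hrow (mem_prefixes.2 (.inr ⟨w, hw, List.prefix_rfl⟩)) (mem_prefixes.2 (.inl rfl)),
        rightCosetMk_eq_iff, ← FreeGroup.one_eq_mk, one_mul]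
      exact inv_mem (Subgroup.subset_closure ⟨w, hw, rfl⟩)
    · intro l _ x hx y hy x' hx' y' hy' h1 h2 h3
      rw [hrow hx hx'] at h1
      rw [hrow hy hy', wordStep_mk h2, wordStep_mk h3]
      exact rightCosetMk_mul_right _ h1 _
  · intro h S _ hS
    have hk := inv_mem (rightCosetMk_eq_iff.1 h)
    rw [mul_inv_rev, inv_inv] at hk
    obtain ⟨w, hw, hwk⟩ := exists_reads_of_mem_closure (G := rowGraph L S) (r := rowOf L S [])
      (MonoidHom.id (FreeGroup ℕ)) (by
        rintro g ⟨w, hw, rfl⟩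
        refine ⟨w, ?_, rfl⟩
        have := rowGraph_reads (S := S) (mem_prefixes.2 (.inr ⟨w, hw, List.prefix_rfl⟩))
        rwa [(isFolded_iff.1 hS).1 w hw] at this) hk
    refine (rowGraph_reads hu).eq_of_mk_eq (rowGraph_det hS) (hw.append (rowGraph_reads hv)) ?_
    rw [← FreeGroup.mul_mk]
    rw [MonoidHom.id_apply] at hwk
    rw [hwk, inv_mul_cancel_right]

/-! ### Counting vertices and edges -/

/-- A list of representatives of the classes of a relation. -/
def classReps {α : Type*} (r : α → α → Bool) (l : List α) : List α :=
  l.foldr (fun x acc => bif acc.any (r x) then acc else x :: acc) []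

theorem length_classReps {α β : Type*} {r : α → α → Bool} {l : List α} {φ : α → β}
    (h : ∀ x ∈ l, ∀ y ∈ l, r x y = true ↔ φ x = φ y) :
    (classReps r l).length = (φ '' {x | x ∈ l}).ncard := by
  classical
  have key : ∀ m : List α, m ⊆ l → classReps r m ⊆ m ∧ ((classReps r m).map φ).Nodup ∧
      ∀ x ∈ m, φ x ∈ (classReps r m).map φ := by
    intro m
    induction m with
    | nil => simp [classReps]
    | cons x m ih =>
      intro hm
      have hx : x ∈ l := hm (by simp)
      obtain ⟨h1, h2, h3⟩ := ih fun y hy => hm (List.mem_cons_of_mem _ hy)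
      have hany : (classReps r m).any (r x) = true ↔ φ x ∈ (classReps r m).map φ := by
        rw [List.any_eq_true, List.mem_map]
        refine exists_congr fun y => and_congr_right fun hy => ?_
        rw [h x hx y (hm (List.mem_cons_of_mem _ (h1 hy))), eq_comm]
      have hcons : classReps r (x :: m) =
          bif (classReps r m).any (r x) then classReps r m else x :: classReps r m := rfl
      rw [hcons]
      cases hc : (classReps r m).any (r x)
      · have hx' : φ x ∉ (classReps r m).map φ := fun hx' => by
          rw [hany.2 hx'] at hc
          exact absurd hc (by simp)
        refine ⟨List.cons_subset_cons x h1, List.nodup_cons.2 ⟨hx', h2⟩, ?_⟩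
        rintro y hy
        rcases List.mem_cons.1 hy with rfl | hy
        · simp
        · exact List.mem_cons_of_mem _ (h3 y hy)
      · refine ⟨fun y hy => List.mem_cons_of_mem _ (h1 hy), h2, ?_⟩
        rintro y hy
        rcases List.mem_cons.1 hy with rfl | hy
        · exact hany.1 hc
        · exact h3 y hy
  obtain ⟨h1, h2, h3⟩ := key l (List.Subset.refl l)
  have himg : φ '' {x | x ∈ l} = (((classReps r l).map φ).toFinset : Set β) := by
    ext y
    simp only [Set.mem_image, Set.mem_ofPred_eq, List.coe_toFinset]
    constructor
    · rintro ⟨x, hx, rfl⟩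
      exact h3 x hx
    · intro hy
      obtain ⟨x, hx, rfl⟩ := List.mem_map.1 hy
      exact ⟨x, h1 hx, rfl⟩
  rw [himg, Set.ncard_coe_finset, List.toFinset_card_of_nodup h2, List.length_map]

/-- The edge of the prefix graph that is traversed by the last letter of a nonempty prefix, given by
a prefix at its initial vertex and its label. -/
def lastEdge (u : Word) : Option (Word × ℕ) :=
  u.reverse.head?.map fun l => (bif l.2 then u.reverse.tail.reverse else u, l.1)

theorem lastEdge_nil : lastEdge [] = none := rfl

theorem lastEdge_concat (p : Word) (a : ℕ) (s : Bool) :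
    lastEdge (p ++ [(a, s)]) = some (bif s then p else p ++ [(a, s)], a) := by
  simp [lastEdge]

/-- The number of vertices of the prefix graph. -/
def vertexCount (L : List Word) : ℕ := (classReps (sameCoset L) (prefixes L)).length

/-- The number of edges of the prefix graph. -/
def edgeCount (L : List Word) : ℕ :=
  (classReps (fun e e' : Word × ℕ => sameCoset L e.1 e'.1 && decide (e.2 = e'.2))
    ((prefixes L).filterMap lastEdge)).length

theorem vertexCount_eq (L : List Word) : vertexCount L =
    Nat.card (PrefixVertex (FreeGroupBasis.ofFreeGroup ℕ) (wordSubgroup L) L) := by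
  rw [vertexCount, length_classReps (r := sameCoset L)
    (φ := fun p => rightCosetMk (wordSubgroup L) (FreeGroup.mk p))
    fun x hx y hy => sameCoset_iff hx hy, Set.ncard]
  refine congrArg Cardinal.toNat (congrArg (fun s : Set _ => Cardinal.mk s) ?_)
  ext x
  exact ⟨fun ⟨p, hp, h⟩ => ⟨p, hp, h.symm⟩, fun ⟨p, hp, h⟩ => ⟨p, hp, h.symm⟩⟩

theorem mem_lastEdges {L : List Word} {x : Word} {a : ℕ} :
    (x, a) ∈ (prefixes L).filterMap lastEdge ↔
      x ++ [(a, true)] ∈ prefixes L ∨ ∃ p, x = p ++ [(a, false)] ∧ x ∈ prefixes L := by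
  rw [List.mem_filterMap]
  constructor
  · rintro ⟨u, hu, h⟩
    rcases List.eq_nil_or_concat' u with rfl | ⟨p, ⟨c, s⟩, rfl⟩
    · simp [lastEdge_nil] at h
    · rw [lastEdge_concat] at h
      cases s
      · simp only [cond_false, Option.some.injEq, Prod.mk.injEq] at h
        obtain ⟨rfl, rfl⟩ := h
        exact .inr ⟨p, rfl, hu⟩
      · simp only [cond_true, Option.some.injEq, Prod.mk.injEq] at h
        obtain ⟨rfl, rfl⟩ := h
        exact .inl hu
  · rintro (h | ⟨p, rfl, h⟩)
    · exact ⟨_, h, by simp [lastEdge_concat]⟩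
    · exact ⟨_, h, by simp [lastEdge_concat]⟩

theorem lastEdges_subset {L : List Word} {e : Word × ℕ}
    (h : e ∈ (prefixes L).filterMap lastEdge) : e.1 ∈ prefixes L := by
  obtain ⟨x, a⟩ := e
  rcases mem_lastEdges.1 h with h | ⟨-, -, h⟩
  · exact prefixes_of_append h
  · exact h

/-- An edge of the prefix graph is determined by its initial vertex and its label. -/
theorem prefixGraph_edge_injective (L : List Word) : Function.Injective
    fun e : (prefixGraph (FreeGroupBasis.ofFreeGroup ℕ) (wordSubgroup L) L).Edges =>
      (e.1.1.1, e.1.2.1) := by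
  rintro ⟨⟨x, a, y⟩, h⟩ ⟨⟨x', a', y'⟩, h'⟩ heq
  simp only [Prod.mk.injEq] at heq
  obtain ⟨hx, rfl⟩ := heq
  obtain rfl := Subtype.ext hx
  have : y = y' := (prefixGraph_isStallings (FreeGroupBasis.ofFreeGroup ℕ) (wordSubgroup L) L
    rfl).det (l := (a, true)) h h'
  subst this
  rfl

theorem prefixGraph_edge_range (L : List Word) : Set.range
    (fun e : (prefixGraph (FreeGroupBasis.ofFreeGroup ℕ) (wordSubgroup L) L).Edges =>
      (e.1.1.1, e.1.2.1)) =
    (fun e : Word × ℕ => (rightCosetMk (wordSubgroup L) (FreeGroup.mk e.1), e.2)) ''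
      {e | e ∈ (prefixes L).filterMap lastEdge} := by
  ext ⟨X, a⟩
  constructor
  · rintro ⟨⟨⟨x, a', y⟩, h⟩, heq⟩
    simp only [Prod.mk.injEq] at heq
    obtain ⟨rfl, rfl⟩ := heq
    rcases h with ⟨p, hp, hx, -⟩ | ⟨p, hp, hx, -⟩
    · exact ⟨(p, a'), mem_lastEdges.2 (.inl hp), Prod.ext hx.symm rfl⟩
    · exact ⟨(p ++ [(a', false)], a'), mem_lastEdges.2 (.inr ⟨p, rfl, hp⟩), Prod.ext hx.symm rfl⟩
  · rintro ⟨⟨x, a'⟩, hmem, heq⟩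
    simp only [Prod.mk.injEq] at heq
    obtain ⟨rfl, rfl⟩ := heq
    rcases mem_lastEdges.1 hmem with h | ⟨p, rfl, h⟩
    · exact ⟨⟨(⟨_, x, prefixes_of_append h, rfl⟩, a', ⟨_, _, h, rfl⟩), .inl ⟨x, h, rfl, rfl⟩⟩, rfl⟩
    · exact ⟨⟨(⟨_, _, h, rfl⟩, a', ⟨_, p, prefixes_of_append h, rfl⟩), .inr ⟨p, h, rfl, rfl⟩⟩, rfl⟩

theorem edgeCount_eq (L : List Word) : edgeCount L =
    Nat.card (prefixGraph (FreeGroupBasis.ofFreeGroup ℕ) (wordSubgroup L) L).Edges := by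
  rw [edgeCount, length_classReps
    (φ := fun e : Word × ℕ => (rightCosetMk (wordSubgroup L) (FreeGroup.mk e.1), e.2)),
    ← prefixGraph_edge_range, ← Nat.card_coe_set_eq,
    Nat.card_range_of_injective (prefixGraph_edge_injective L)]
  intro e he e' he'
  rw [Bool.and_eq_true, sameCoset_iff (lastEdges_subset he) (lastEdges_subset he'),
    decide_eq_true_eq, Prod.mk.injEq]

theorem card_add_vertexCount (L : List Word) {ι : Type*} (κ : FreeGroupBasis ι (wordSubgroup L)) :
    Nat.card ι + vertexCount L = edgeCount L + 1 := by
  have : Finite (prefixGraph (FreeGroupBasis.ofFreeGroup ℕ) (wordSubgroup L) L).Edges := by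
    refine Set.finite_range_iff (prefixGraph_edge_injective L) |>.1 ?_
    rw [prefixGraph_edge_range]
    exact (List.finite_toSet _).image _
  rw [vertexCount_eq, edgeCount_eq]
  exact (prefixGraph_isStallings (FreeGroupBasis.ofFreeGroup ℕ) (wordSubgroup L) L
    rfl).card_add_card κ

end Algorithm

section Primitive

open LabelledGraph

/-! ### The algorithm is primitive recursive -/

/-- The word `u v⁻¹` for a pair of words. -/
def quotientWord (p : Word × Word) : Word := p.1 ++ FreeGroup.invRev p.2

/-- Adjoining `u v⁻¹` does not raise the rank of the subgroup generated by `L`; the ranks are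
compared through the Euler characteristics of the prefix graphs. -/
def dependenceTest (L : List Word) (p : Word × Word) : Bool :=
  decide (edgeCount (quotientWord p :: L) + vertexCount L ≤
    edgeCount L + vertexCount (quotientWord p :: L))

/-- Generators of the dependent subgroup: the given words, together with all dependent quotients of
prefixes. -/
def dependentWords (L : List Word) : List Word :=
  L ++ ((listPairs (prefixes L)).filter (dependenceTest L)).map quotientWord

section Lists

variable {α : Type*} {β : Type*} {σ : Type*} [Primcodable α] [Primcodable β] [Primcodable σ]

theorem primrec_all {f : α → List β} {p : α → β → Bool} (hf : Primrec f) (hp : Primrec₂ p) :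
    Primrec fun a => (f a).all (p a) := by
  have h : Primrec₂ fun (a : α) (x : β × Bool) => p a x.1 && x.2 :=
    Primrec.and.comp (hp.comp .fst (Primrec.fst.comp .snd)) (Primrec.snd.comp .snd)
  refine (Primrec.list_foldr hf (Primrec.const true) h).of_eq fun a => ?_
  induction f a with
  | nil => rfl
  | cons b l ih => rw [List.foldr_cons, ih, List.all_cons]

theorem primrec_any {f : α → List β} {p : α → β → Bool} (hf : Primrec f) (hp : Primrec₂ p) :
    Primrec fun a => (f a).any (p a) :=
  (Primrec.not.comp (primrec_all hf (Primrec.not.comp₂ hp))).of_eq fun a => by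
    rw [List.not_all_eq_any_not]; simp

theorem primrec_filter {f : α → List β} {p : α → β → Bool} (hf : Primrec f) (hp : Primrec₂ p) :
    Primrec fun a => (f a).filter (p a) := by
  have h : Primrec₂ fun (a : α) (x : β) => bif p a x then some x else none :=
    Primrec.cond hp (Primrec.option_some.comp .snd) (Primrec.const none)
  refine (Primrec.listFilterMap hf h).of_eq fun a => ?_
  rw [← List.filterMap_eq_filter]
  refine congrArg (fun q => List.filterMap q (f a)) (funext fun x => ?_)
  cases h : p a x <;> simp [Option.guard, h]

theorem primrec_and {f g : α → Bool} (hf : Primrec f) (hg : Primrec g) :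
    Primrec fun a => f a && g a :=
  Primrec.and.comp hf hg

theorem primrec_or {f g : α → Bool} (hf : Primrec f) (hg : Primrec g) :
    Primrec fun a => f a || g a :=
  Primrec.or.comp hf hg

theorem primrec_not {f : α → Bool} (hf : Primrec f) : Primrec fun a => !f a :=
  Primrec.not.comp hf

theorem primrec_decide_eq {f g : α → β} [∀ a, Decidable (f a = g a)] (hf : Primrec f)
    (hg : Primrec g) : Primrec fun a => decide (f a = g a) := by
  classical
  exact (Primrec.eq.comp hf hg).decide.of_eq fun a => by simp

theorem primrec_decide_mem {f : α → β} {g : α → List β} [∀ a, Decidable (f a ∈ g a)]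
    (hf : Primrec f) (hg : Primrec g) : Primrec fun a => decide (f a ∈ g a) := by
  classical
  exact (primrec_any hg (p := fun a x => decide (f a = x))
    (primrec_decide_eq (hf.comp .fst) .snd)).of_eq fun a => by
      rw [Bool.eq_iff_iff]; simp

theorem primrec_listPairs : Primrec (listPairs (α := α)) :=
  Primrec.list_flatMap .id (Primrec.list_map .fst
    (Primrec.pair (Primrec.snd.comp .fst) .snd).to₂).to₂

theorem primrec_sublists' : Primrec (List.sublists' (α := α)) := by
  have h : Primrec₂ fun (_ : List α) (x : α × List (List α)) => x.2 ++ x.2.map (List.cons x.1) :=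
    Primrec.list_append.comp (Primrec.snd.comp .snd) (Primrec.list_map (Primrec.snd.comp .snd)
      (Primrec.list_cons.comp (Primrec.fst.comp (Primrec.snd.comp .fst)) .snd).to₂)
  refine (Primrec.list_foldr .id (Primrec.const [[]]) h).of_eq fun l => ?_
  induction l with
  | nil => rfl
  | cons a l ih =>
    rw [id, List.foldr_cons, List.sublists'_cons]
    rw [id] at ih
    rw [ih]

theorem primrec_inits : Primrec (List.inits (α := α)) := by
  have h : Primrec₂ fun (_ : List α) (x : α × List (List α)) => [] :: x.2.map (List.cons x.1) :=
    Primrec.list_cons.comp (Primrec.const []) (Primrec.list_map (Primrec.snd.comp .snd)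
      (Primrec.list_cons.comp (Primrec.fst.comp (Primrec.snd.comp .fst)) .snd).to₂)
  refine (Primrec.list_foldr .id (Primrec.const [[]]) h).of_eq fun l => ?_
  induction l with
  | nil => rfl
  | cons a l ih =>
    rw [id, List.foldr_cons, List.inits_cons]
    rw [id] at ih
    rw [ih]

theorem primrec_prefixes : Primrec (prefixes (α := α)) :=
  Primrec.list_cons.comp (Primrec.const [])
    (Primrec.list_flatMap .id (primrec_inits.comp .snd).to₂)

theorem primrec_classReps {r : σ → α → α → Bool} {f : σ → List α}
    (hr : Primrec fun x : σ × α × α => r x.1 x.2.1 x.2.2) (hf : Primrec f) :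
    Primrec fun s => classReps (r s) (f s) := by
  have hany : Primrec fun y : σ × α × List α => y.2.2.any (r y.1 y.2.1) :=
    primrec_any (Primrec.snd.comp .snd) (p := fun (y : σ × α × List α) z => r y.1 y.2.1 z)
      (hr.comp (Primrec.pair (Primrec.fst.comp .fst)
        (Primrec.pair (Primrec.fst.comp (Primrec.snd.comp .fst)) .snd)))
  have h : Primrec₂ fun (s : σ) (x : α × List α) =>
      bif x.2.any (r s x.1) then x.2 else x.1 :: x.2 :=
    Primrec.cond hany (Primrec.snd.comp .snd)
      (Primrec.list_cons.comp (Primrec.fst.comp .snd) (Primrec.snd.comp .snd))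
  exact Primrec.list_foldr hf (Primrec.const []) h

end Lists

theorem primrec_invLetter : Primrec fun l : ℕ × Bool => (l.1, !l.2) :=
  Primrec.pair .fst (Primrec.not.comp .snd)

theorem primrec_quotientWord : Primrec quotientWord :=
  Primrec.list_append.comp .fst
    (Primrec.list_reverse.comp (Primrec.list_map .snd (primrec_invLetter.comp .snd).to₂))

theorem primrec_signedLetters : Primrec signedLetters :=
  Primrec.list_flatMap Primrec.list_flatten (Primrec.list_cons.comp .snd
    (Primrec.list_cons.comp (primrec_invLetter.comp .snd) (Primrec.const []))).to₂

theorem primrec_rowOf : Primrec fun x : (List Word × List (Word × Word)) × Word =>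
    rowOf x.1.1 x.1.2 x.2 :=
  primrec_filter (primrec_prefixes.comp (Primrec.fst.comp .fst))
    (p := fun (x : (List Word × List (Word × Word)) × Word) v => decide ((x.2, v) ∈ x.1.2))
    (primrec_decide_mem (Primrec.pair (Primrec.snd.comp .fst) .snd)
      (Primrec.snd.comp (Primrec.fst.comp .fst)))

theorem primrec_isWordStep : Primrec fun x : (ℕ × Bool) × Word × Word => isWordStep x.1 x.2 := by
  have hc : ∀ {f : (ℕ × Bool) × Word × Word → Word} {g : (ℕ × Bool) × Word × Word → ℕ × Bool},
      Primrec f → Primrec g → Primrec fun x => f x ++ [g x] := fun hf hg =>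
    Primrec.list_append.comp hf (Primrec.list_cons.comp hg (Primrec.const []))
  exact primrec_or
    (primrec_decide_eq (Primrec.snd.comp .snd) (hc (Primrec.fst.comp .snd) .fst))
    (primrec_decide_eq (Primrec.fst.comp .snd)
      (hc (Primrec.snd.comp .snd) (primrec_invLetter.comp .fst)))

theorem primrec_foldCondition {α : Type*} [Primcodable α] {c : α → List Word × List (Word × Word)}
    {e e' : α → Word × Word} {l : α → ℕ × Bool} (hc : Primrec c) (he : Primrec e)
    (he' : Primrec e') (hl : Primrec l) :
    Primrec fun t => foldCondition (c t).1 (c t).2 (e t) (e' t) (l t) := by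
  have hrow : ∀ {f : α → Word}, Primrec f → Primrec fun t => rowOf (c t).1 (c t).2 (f t) :=
    fun hf => primrec_rowOf.comp (Primrec.pair hc hf)
  have h1 := primrec_decide_eq (hrow (Primrec.fst.comp he)) (hrow (Primrec.fst.comp he'))
  have h2 := primrec_decide_eq (hrow (Primrec.snd.comp he)) (hrow (Primrec.snd.comp he'))
  have h3 := primrec_isWordStep.comp (Primrec.pair hl he)
  have h4 := primrec_isWordStep.comp (Primrec.pair hl he')
  exact primrec_or (primrec_not (primrec_and (primrec_and h1 h3) h4)) h2

theorem primrec_isFolded : Primrec fun x : List Word × List (Word × Word) =>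
    isFolded x.1 x.2 := by
  have hpairs : Primrec fun L : List Word => listPairs (prefixes L) :=
    primrec_listPairs.comp primrec_prefixes
  have hnil := primrec_rowOf.comp (Primrec.pair (Primrec.fst (α := List Word × List (Word × Word))
    (β := Word)) (Primrec.const []))
  have h₀ := primrec_all Primrec.fst
    (p := fun (x : List Word × List (Word × Word)) w => decide (rowOf x.1 x.2 w = rowOf x.1 x.2 []))
    (primrec_decide_eq primrec_rowOf hnil)
  have h₁ := primrec_foldCondition
    (α := (((List Word × List (Word × Word)) × Word × Word) × Word × Word) × ℕ × Bool)
    (Primrec.fst.comp (Primrec.fst.comp .fst)) (Primrec.snd.comp (Primrec.fst.comp .fst))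
    (Primrec.snd.comp .fst) .snd
  have h₂ := primrec_all
    (primrec_signedLetters.comp (Primrec.fst.comp (Primrec.fst.comp .fst)))
    (p := fun (z : ((List Word × List (Word × Word)) × Word × Word) × Word × Word) l =>
      foldCondition z.1.1.1 z.1.1.2 z.1.2 z.2 l) h₁
  have h₃ := primrec_all (hpairs.comp (Primrec.fst.comp .fst))
    (p := fun (y : (List Word × List (Word × Word)) × Word × Word) e' =>
      (signedLetters y.1.1).all fun l => foldCondition y.1.1 y.1.2 y.2 e' l) h₂
  exact primrec_and h₀ (primrec_all (hpairs.comp .fst)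
    (p := fun (x : List Word × List (Word × Word)) e => (listPairs (prefixes x.1)).all fun e' =>
      (signedLetters x.1).all fun l => foldCondition x.1 x.2 e e' l) h₃)

theorem primrec_sameCoset : Primrec fun x : List Word × Word × Word =>
    sameCoset x.1 x.2.1 x.2.2 := by
  have hctx : Primrec fun t : (List Word × Word × Word) × List (Word × Word) => (t.1.1, t.2) :=
    Primrec.pair (Primrec.fst.comp .fst) .snd
  have h : Primrec fun t : (List Word × Word × Word) × List (Word × Word) =>
      !isFolded t.1.1 t.2 || decide (rowOf t.1.1 t.2 t.1.2.1 = rowOf t.1.1 t.2 t.1.2.2) :=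
    primrec_or (primrec_not (primrec_isFolded.comp hctx))
      (primrec_decide_eq
        (primrec_rowOf.comp (Primrec.pair hctx (Primrec.fst.comp (Primrec.snd.comp .fst))))
        (primrec_rowOf.comp (Primrec.pair hctx (Primrec.snd.comp (Primrec.snd.comp .fst)))))
  exact primrec_all
    (primrec_sublists'.comp (primrec_listPairs.comp (primrec_prefixes.comp .fst))) h.to₂

theorem primrec_vertexCount : Primrec vertexCount :=
  Primrec.list_length.comp (primrec_classReps primrec_sameCoset primrec_prefixes)

theorem primrec_lastEdge : Primrec lastEdge := by
  refine Primrec.option_map (Primrec.list_head?.comp Primrec.list_reverse) ?_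
  exact Primrec.pair (Primrec.cond (Primrec.snd.comp .snd)
    (Primrec.list_reverse.comp (Primrec.list_tail.comp (Primrec.list_reverse.comp .fst))) .fst)
    (Primrec.fst.comp .snd)

theorem primrec_edgeCount : Primrec edgeCount := by
  have he : Primrec fun t : List Word × (Word × ℕ) × Word × ℕ => t.2.1 := Primrec.fst.comp .snd
  have he' : Primrec fun t : List Word × (Word × ℕ) × Word × ℕ => t.2.2 := Primrec.snd.comp .snd
  have h1 := primrec_sameCoset.comp (Primrec.pair Primrec.fst
    (Primrec.pair (Primrec.fst.comp he) (Primrec.fst.comp he')))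
  have h2 := primrec_decide_eq (Primrec.snd.comp he) (Primrec.snd.comp he')
  have h3 : Primrec fun L : List Word => (prefixes L).filterMap lastEdge :=
    Primrec.listFilterMap primrec_prefixes (primrec_lastEdge.comp .snd)
  exact Primrec.list_length.comp (primrec_classReps
    (r := fun L (e e' : Word × ℕ) => sameCoset L e.1 e'.1 && decide (e.2 = e'.2))
    (primrec_and h1 h2) h3)

theorem primrec_dependentWords : Primrec dependentWords := by
  have hcons : Primrec fun x : List Word × Word × Word => quotientWord x.2 :: x.1 :=
    Primrec.list_cons.comp (primrec_quotientWord.comp .snd) .fst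
  have htest : Primrec₂ dependenceTest :=
    (Primrec.nat_le.comp
      (Primrec.nat_add.comp (primrec_edgeCount.comp hcons) (primrec_vertexCount.comp .fst))
      (Primrec.nat_add.comp (primrec_edgeCount.comp .fst) (primrec_vertexCount.comp hcons))).decide
  exact Primrec.list_append.comp .id (Primrec.list_map
    (primrec_filter (primrec_listPairs.comp primrec_prefixes) htest)
    (primrec_quotientWord.comp .snd).to₂)

end Primitive

section Correctness

open LabelledGraph

/-! ### Correctness of the algorithm -/

theorem mk_quotientWord (p : Word × Word) :
    FreeGroup.mk (quotientWord p) = FreeGroup.mk p.1 * (FreeGroup.mk p.2)⁻¹ := by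
  rw [quotientWord, FreeGroup.inv_mk, FreeGroup.mul_mk]

theorem wordSubgroup_cons (w : Word) (L : List Word) :
    wordSubgroup (w :: L) = wordSubgroup L ⊔ Subgroup.zpowers (FreeGroup.mk w) := by
  rw [wordSubgroup, wordSubgroup, Subgroup.zpowers_eq_closure, ← Subgroup.closure_union]
  congr 1
  ext g
  simp [eq_comm]

theorem fg_closure_words {F : Type*} [Group F] {α : Type*} (φ : α → F) (L : List α) :
    (Subgroup.closure {g | ∃ w ∈ L, φ w = g}).FG :=
  (Subgroup.fg_iff _).2 ⟨_, rfl, (List.finite_toSet L).image φ⟩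

theorem dependenceTest_iff (L : List Word) (p : Word × Word) : dependenceTest L p = true ↔
    DependsOnSubgroup (FreeGroup.mk p.1 * (FreeGroup.mk p.2)⁻¹) (wordSubgroup L) := by
  have h1 : Group.FG (wordSubgroup L) := (Group.fg_iff_subgroup_fg _).2 (fg_closure_words _ L)
  have h2 : Group.FG (wordSubgroup (quotientWord p :: L)) :=
    (Group.fg_iff_subgroup_fg _).2 (fg_closure_words _ _)
  have e := MulEquiv.subgroupCongr (wordSubgroup_cons (quotientWord p) L)
  rw [← mk_quotientWord, dependsOnSubgroup_iff (IsFreeGroup.basis (wordSubgroup L))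
    ((IsFreeGroup.basis (wordSubgroup (quotientWord p :: L))).map e), dependenceTest,
    decide_eq_true_eq]
  have f1 := (IsFreeGroup.basis (wordSubgroup L)).finite_of_fg
  have f2 := (IsFreeGroup.basis (wordSubgroup (quotientWord p :: L))).finite_of_fg
  have c1 := card_add_vertexCount _ (IsFreeGroup.basis (wordSubgroup L))
  have c2 := card_add_vertexCount _ (IsFreeGroup.basis (wordSubgroup (quotientWord p :: L)))
  rw [← Nat.cast_card, ← Nat.cast_card, Nat.cast_le]
  omega

theorem lettersOf_of_mem {L : List Word} {w : Word} (hw : w ∈ L) {l : ℕ × Bool} (hl : l ∈ w) :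
    l.1 ∈ lettersOf L :=
  ⟨w, hw, l.2, hl⟩

theorem lettersOf_of_mem_prefixes {L : List Word} {w : Word} (hw : w ∈ prefixes L) {l : ℕ × Bool}
    (hl : l ∈ w) : l.1 ∈ lettersOf L := by
  rcases mem_prefixes.1 hw with rfl | ⟨w', hw', h⟩
  · simp at hl
  · exact lettersOf_of_mem hw' (h.subset hl)

theorem lettersOf_dependentWords (L : List Word) :
    lettersOf (dependentWords L) ⊆ lettersOf L := by
  rintro i ⟨w, hw, s, hl⟩
  rcases List.mem_append.1 hw with hw | hw
  · exact lettersOf_of_mem hw hl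
  · obtain ⟨p, hp, rfl⟩ := List.mem_map.1 hw
    have hp' := mem_listPairs.1 (List.mem_filter.1 hp).1
    rcases List.mem_append.1 hl with hl | hl
    · exact lettersOf_of_mem_prefixes hp'.1 hl
    · rw [FreeGroup.invRev, List.mem_reverse, List.mem_map] at hl
      simp only [Prod.mk.injEq] at hl
      obtain ⟨m, hm, rfl, -⟩ := hl
      exact lettersOf_of_mem_prefixes hp'.2 hm

theorem mk_mem_closure_of_letters {S : Set ℕ} {w : Word} (hw : ∀ l ∈ w, l.1 ∈ S) :
    FreeGroup.mk w ∈ Subgroup.closure (FreeGroup.of '' S) := by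
  induction w with
  | nil => exact one_mem _
  | cons l w ih =>
    rw [show FreeGroup.mk (l :: w) = FreeGroup.mk [l] * FreeGroup.mk w by
      rw [FreeGroup.mul_mk]; rfl]
    refine mul_mem ?_ (ih fun m hm => hw m (List.mem_cons_of_mem _ hm))
    have hl : FreeGroup.of l.1 ∈ Subgroup.closure (FreeGroup.of '' S) :=
      Subgroup.subset_closure ⟨_, hw l (by simp), rfl⟩
    obtain ⟨a, s⟩ := l
    cases s
    · exact inv_mem hl
    · exact hl

section Transfer

variable {F : Type u} [Group F] {A : Type v} (b : FreeGroupBasis A F)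

theorem subgroupOfWords_eq_map (e : ℕ → F) (L : List Word) :
    subgroupOfWords e L = (wordSubgroup L).map (FreeGroup.lift e) := by
  rw [subgroupOfWords, wordSubgroup, MonoidHom.map_closure]
  congr 1
  ext g
  simp [evalWord]

theorem subgroupOfWords_congr {e e' : ℕ → F} {L : List Word} {S : Set ℕ} (hL : lettersOf L ⊆ S)
    (h : Set.EqOn e e' S) : subgroupOfWords e L = subgroupOfWords e' L := by
  have : ∀ w ∈ L, evalWord e w = evalWord e' w := fun w hw => by
    rw [evalWord, evalWord, FreeGroup.lift_mk, FreeGroup.lift_mk]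
    refine congrArg List.prod (List.map_congr_left fun l hl => ?_)
    rw [h (hL (lettersOf_of_mem hw hl))]
  rw [subgroupOfWords, subgroupOfWords]
  congr 1
  ext g
  exact exists_congr fun w => and_congr_right fun hw => by rw [this w hw]

theorem wordValue_map (α : ℕ → A) (w : Word) :
    wordValue b (w.map fun l => (α l.1, l.2)) = FreeGroup.lift (b ∘ α) (FreeGroup.mk w) := by
  have : b.repr.symm.toMonoidHom.comp (FreeGroup.map α) = FreeGroup.lift (b ∘ α) := by
    ext i
    simp
    rfl
  rw [← this]
  rfl

/-- Distinct basis elements generate freely, also when they are indexed by a subset of `ℕ`. -/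
theorem lift_eq_one_of_mem_closure {α : ℕ → A} {S : Set ℕ} (hα : Set.InjOn α S)
    {x : FreeGroup ℕ} (hx : x ∈ Subgroup.closure (FreeGroup.of '' S))
    (h : FreeGroup.lift (b ∘ α) x = 1) : x = 1 := by
  classical
  let β : F →* FreeGroup ℕ :=
    b.lift fun a => if h : ∃ i ∈ S, α i = a then FreeGroup.of h.choose else 1
  have hβ : Set.EqOn (β.comp (FreeGroup.lift (b ∘ α))) (MonoidHom.id _) (FreeGroup.of '' S) := by
    rintro _ ⟨i, hi, rfl⟩
    have hex : ∃ j ∈ S, α j = α i := ⟨i, hi, rfl⟩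
    have hj : hex.choose = i := hα hex.choose_spec.1 hi hex.choose_spec.2
    simp only [MonoidHom.comp_apply, FreeGroup.lift_apply_of, Function.comp_apply,
      MonoidHom.id_apply, β, FreeGroupBasis.lift_apply_apply, FreeGroupBasis.repr_apply_coe,
      dif_pos hex, hj]
  have := MonoidHom.eqOn_closure hβ hx
  simpa [h] using this.symm

/-- The algorithm is correct when the letters stand for distinct elements of the basis. -/
theorem subgroupOfWords_dependentWords_comp {α : ℕ → A} {L : List Word}
    (hα : Set.InjOn α (lettersOf L)) : subgroupOfWords (b ∘ α) (dependentWords L) =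
      dependentSubgroup (subgroupOfWords (b ∘ α) L) := by
  have := b.isFreeGroup
  set H := subgroupOfWords (b ∘ α) L with hH
  have hfg : Group.FG H := (Group.fg_iff_subgroup_fg _).2 (fg_closure_words _ L)
  have hclos : ∀ {w}, w ∈ prefixes L →
      FreeGroup.mk w ∈ Subgroup.closure (FreeGroup.of '' lettersOf L) := fun hw =>
    mk_mem_closure_of_letters fun l hl => lettersOf_of_mem_prefixes hw hl
  have hsub : wordSubgroup L ≤ Subgroup.closure (FreeGroup.of '' lettersOf L) := by
    rw [wordSubgroup, Subgroup.closure_le]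
    rintro _ ⟨w, hw, rfl⟩
    exact hclos (mem_prefixes.2 (.inr ⟨w, hw, List.prefix_rfl⟩))
  have htest : ∀ {u v}, u ∈ prefixes L → v ∈ prefixes L → (dependenceTest L (u, v) = true ↔
      DependsOnSubgroup (evalWord (b ∘ α) (quotientWord (u, v))) H) := by
    intro u v hu hv
    rw [dependenceTest_iff, hH, subgroupOfWords_eq_map, evalWord, mk_quotientWord]
    refine (dependsOnSubgroup_map_iff (FreeGroup.lift (b ∘ α)) fun x hx h => ?_).symm
    refine lift_eq_one_of_mem_closure b hα ?_ h
    exact sup_le hsub (Subgroup.zpowers_le.2 (mul_mem (hclos hu) (inv_mem (hclos hv)))) hx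
  apply le_antisymm
  · rw [subgroupOfWords, Subgroup.closure_le]
    rintro _ ⟨w, hw, rfl⟩
    rcases List.mem_append.1 hw with hw | hw
    · exact le_dependentSubgroup (Subgroup.subset_closure ⟨w, hw, rfl⟩)
    · obtain ⟨⟨u, v⟩, hp, rfl⟩ := List.mem_map.1 hw
      obtain ⟨hp, ht⟩ := List.mem_filter.1 hp
      obtain ⟨hu, hv⟩ := mem_listPairs.1 hp
      exact Subgroup.subset_closure ((htest hu hv).1 ht)
  · have hle : H ≤ subgroupOfWords (b ∘ α) (dependentWords L) := by
      rw [hH, subgroupOfWords, Subgroup.closure_le]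
      rintro _ ⟨w, hw, rfl⟩
      exact Subgroup.subset_closure ⟨w, List.mem_append_left _ hw, rfl⟩
    rw [dependentSubgroup, Subgroup.closure_le]
    intro g hg
    -- read `g` in the prefix graph of the words, written in the letters from `A`
    let L' : List (List (A × Bool)) := L.map fun w => w.map fun l => (α l.1, l.2)
    have hL' : Subgroup.closure {g | ∃ w ∈ L', wordValue b w = g} = H := by
      rw [hH, subgroupOfWords]
      congr 1
      ext g
      simp only [L', List.mem_map, exists_exists_and_eq_and, wordValue_map, evalWord]
    have hpre : ∀ {p}, p ∈ prefixes L' → ∃ q ∈ prefixes L,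
        wordValue b p = FreeGroup.lift (b ∘ α) (FreeGroup.mk q) := by
      intro p hp
      rcases mem_prefixes.1 hp with rfl | ⟨w, hw, t, ht⟩
      · exact ⟨[], mem_prefixes.2 (.inl rfl), by rw [wordValue_nil]; exact (map_one _).symm⟩
      · obtain ⟨w, hwL, rfl⟩ := List.mem_map.1 hw
        obtain ⟨q, t', rfl, rfl, -⟩ := List.map_eq_append_iff.1 ht.symm
        exact ⟨q, mem_prefixes.2 (.inr ⟨_, hwL, t', rfl⟩), wordValue_map b α q⟩
    have hst := prefixGraph_isStallings b H L' hL'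
    obtain ⟨w, w', ⟨y, p, hp, rfl⟩, ⟨y', p', hp', rfl⟩, hw, hw', rfl⟩ :=
      hst.exists_reads_of_depends hg
    have h1 := (schreierGraph_reads_iff b H).1 (prefixGraph_reads_le b H L' hw)
    have h2 := (schreierGraph_reads_iff b H).1 (prefixGraph_reads_le b H L' hw')
    rw [one_mul] at h1 h2
    have h1 := rightCosetMk_eq_iff.1 h1
    have h2 := rightCosetMk_eq_iff.1 h2
    obtain ⟨u, hu, hpu⟩ := hpre hp
    obtain ⟨v, hv, hpv⟩ := hpre hp'
    have heval : evalWord (b ∘ α) (quotientWord (u, v)) = wordValue b p * (wordValue b p')⁻¹ := by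
      rw [evalWord, mk_quotientWord, map_mul, map_inv, hpu, hpv]
    have heq : wordValue b w * (wordValue b w')⁻¹ = wordValue b w * (wordValue b p)⁻¹ *
        (wordValue b p * (wordValue b p')⁻¹) * (wordValue b w' * (wordValue b p')⁻¹)⁻¹ := by group
    have hdep : DependsOnSubgroup (evalWord (b ∘ α) (quotientWord (u, v))) H := by
      rw [heval]
      refine (dependsOnSubgroup_congr (sup_zpowers_mul_mul H _ h1 (inv_mem h2))).1 ?_
      rwa [← heq]
    rw [heq]
    refine mul_mem (mul_mem (hle h1) ?_) (hle (inv_mem h2))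
    rw [← heval]
    exact Subgroup.subset_closure ⟨_, List.mem_append_right _ (List.mem_map.2 ⟨(u, v),
      List.mem_filter.2 ⟨mem_listPairs.2 ⟨hu, hv⟩, (htest hu hv).2 hdep⟩, rfl⟩), rfl⟩

theorem subgroupOfWords_dependentWords {L : List Word} {e : ℕ → F}
    (he : Set.MapsTo e (lettersOf L) (Set.range b)) (hinj : Set.InjOn e (lettersOf L)) :
    subgroupOfWords e (dependentWords L) = dependentSubgroup (subgroupOfWords e L) := by
  classical
  rcases isEmpty_or_nonempty A with hA | ⟨⟨a₀⟩⟩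
  · have : Subsingleton F := b.repr.injective.subsingleton
    exact Subsingleton.elim _ _
  let α : ℕ → A := fun i => if h : ∃ a, b a = e i then h.choose else a₀
  have hα : Set.EqOn e (b ∘ α) (lettersOf L) := fun i hi => by
    have hex : ∃ a, b a = e i := he hi
    simp only [Function.comp_apply, α, dif_pos hex]
    exact hex.choose_spec.symm
  rw [subgroupOfWords_congr (lettersOf_dependentWords L) hα,
    subgroupOfWords_congr (Set.Subset.refl _) hα]
  refine subgroupOfWords_dependentWords_comp b fun i hi j hj h => hinj hi hj ?_
  rw [hα hi, hα hj, Function.comp_apply, Function.comp_apply, h]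

end Transfer

end Correctness

theorem theorem2p3 :
    (∃ f : List (List (ℕ × Bool)) → List (List (ℕ × Bool)), Computable f ∧
      (∀ L : List (List (ℕ × Bool)), lettersOf (f L) ⊆ lettersOf L) ∧
      ∀ (F : Type u) [Group F] (A : Type v) (b : FreeGroupBasis A F)
        (L : List (List (ℕ × Bool))) (e : ℕ → F),
        Set.MapsTo e (lettersOf L) (Set.range b) → Set.InjOn e (lettersOf L) →
          subgroupOfWords e (f L) = dependentSubgroup (subgroupOfWords e L)) ∧
    (∀ (F : Type u) [Group F] (A : Type v) (b : FreeGroupBasis A F)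
      (H : Subgroup F), H.FG →
      ∀ rep : CoreVertex b H → F, (∀ x : CoreVertex b H, rightCosetMk H (rep x) = x) →
        dependentSubgroup H =
            Subgroup.closure ((H : Set F) ∪
              {g | ∃ p ∈ nonRaisingPairs b H, g = rep p.1 * (rep p.2)⁻¹}) ∧
          (nonRaisingPairs b H).Finite ∧
          dependentSet H =
            ⋃ p ∈ nonRaisingPairs b H,
              DoubleCoset.doubleCoset (rep p.1 * (rep p.2)⁻¹) (H : Set F) (H : Set F)) := by
  refine ⟨⟨dependentWords, primrec_dependentWords.to_comp, lettersOf_dependentWords,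
    fun F _ A b L e he hinj => subgroupOfWords_dependentWords b he hinj⟩, ?_⟩
  intro F _ A b H hH rep hrep
  exact ⟨LabelledGraph.dependentSubgroup_eq_closure hH hrep,
    LabelledGraph.finite_nonRaisingPairs hH, LabelledGraph.dependentSet_eq_iUnion hH hrep⟩
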